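/- Let $\alpha=(\alpha_1,\dots,\alpha_n)\in\mathbb{Z}_{\ge 0}^n$ be a composition. Its key polynomial $\kappa_\alpha\in\mathbb{Z}[x_1,\dots,x_n]$ is defined recursively: if $\alpha$ is weakly decreasing, then $\kappa_\alpha=x_1^{\alpha_1}\cdots x_n^{\alpha_n}$; otherwise choose any $i$ with $\alpha_i<\alpha_{i+1}$ and put $\kappa_\alpha=\partial_i(x_i\,\kappa_{\alpha'})$, where $\alpha'$ is obtained from $\alpha$ by exchanging $\alpha_i$ and $\alpha_{i+1}$, and $\partial_i f=(f-s_if)/(x_i-x_{i+1})$, with $s_i f$ obtained from $f$ by exchanging $x_i$ and $x_{i+1}$. (The statement below holds for the polynomial produced by any choice of the indices $i$.) Let $\mathcal{S}_\alpha=\mathrm{Newton}(\kappa_\alpha)\subset\mathbb{R}^n$ be its Newton polytope, the convex hull of the exponent vectors of $\kappa_\alpha$. A polytope $P\subset\mathbb{R}^n$ is called lattice-free if $P\cap\mathbb{Z}^n$ is exactly the set of vertices of $P$. For a nonnegative integer $t$ write $i(P,t)=|tP\cap\mathbb{Z}^n|$; for an integral polytope this is its Ehrhart polynomial. For $j\ge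 1$ let $D_j=\{i\in[n]:\alpha_i\ge j\}$ be the $j$-th column of the skyline diagram $D(\alpha)$, which has $\alpha_i$ left-justified boxes in row $i$. For $S\subseteq[n]$ let $SM_n(S)$ be the Schubert matroid on $[n]$, whose bases are the sets $T\subseteq [n]$ with $|T|=|S|$ such that, writing $T=\{a_1<\dots<a_k\}$ and $S=\{b_1<\dots<b_k\}$, one has $a_l\le b_l$ for all $l$; and let $P(SM_n(S))$ be its matroid base polytope, the convex hull of the indicator vectors of its bases. Let $N$ be any integer with $N\ge\alpha_i$ for all $i\in[n]$ and $N\ge 0$. Then the following conditions are equivalent: 1. $\mathcal{S}_\alpha$ is lattice-free; 2. $\alpha$ avoids the composition pattern $(0,2)$, i.e., there do not exist $i<j$ with $\alpha_j-\alpha_i\ge 2$; 3. $i(\mathcal{S}_\alpha,t)=\prod_{j=1}^{N} i(P(SM_n(D_j)),t)$ for all integers $t\ge 0$, i.e., the Ehrhart polynomial of $\mathcal{S}_\alpha$ is the product of the Ehrhart polynomials of the Schubert matroid polytopes of the columns of $D(\alpha)$. -/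

import Mathlib

open scoped Pointwise

/-! ### Lattice polytopes -/

/-- The integer points `ℤⁿ` of `ℝⁿ`. -/
def integerLattice (n : ℕ) : Set (Fin n → ℝ) :=
  {x | ∀ i, ∃ z : ℤ, x i = (z : ℝ)}

/-- A polytope is lattice-free if its lattice points are exactly its vertices. -/
def IsLatticeFree {n : ℕ} (P : Set (Fin n → ℝ)) : Prop :=
  P ∩ integerLattice n = P.extremePoints ℝ

/-- The Ehrhart counting function `i(P, t) = |tP ∩ ℤⁿ|` (used for bounded `P`). -/
noncomputable def ehrhart {n : ℕ} (P : Set (Fin n → ℝ)) (t : ℕ) : ℕ :=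
  (((t : ℝ) • P) ∩ integerLattice n).ncard

/-- The Newton polytope of a polynomial: the convex hull of its exponent vectors. -/
def newtonPolytope {n : ℕ} (f : MvPolynomial (Fin n) ℤ) : Set (Fin n → ℝ) :=
  convexHull ℝ ((fun (m : Fin n →₀ ℕ) (i : Fin n) => ((m i : ℕ) : ℝ)) '' (f.support : Set (Fin n →₀ ℕ)))

/-! ### Divided differences and key polynomials -/

/-- `f - s f` is divisible by `x_i - x_j`, where `s` exchanges `x_i` and `x_j`. -/
theorem sub_dvd_sub_rename_swap {n : ℕ} (i j : Fin n) (f : MvPolynomial (Fin n) ℤ) :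
    (MvPolynomial.X i - MvPolynomial.X j : MvPolynomial (Fin n) ℤ) ∣
      f - MvPolynomial.rename (Equiv.swap i j) f := by
  induction f using MvPolynomial.induction_on with
  | C a => simp
  | add p q hp hq =>
    rw [map_add, add_sub_add_comm]
    exact dvd_add hp hq
  | mul_X p k hp =>
    have hk : (MvPolynomial.X i - MvPolynomial.X j : MvPolynomial (Fin n) ℤ) ∣
        MvPolynomial.X k - MvPolynomial.X (Equiv.swap i j k) := by
      by_cases h1 : k = i
      · subst h1; simp
      · by_cases h2 : k = j
        · subst h2
          rw [Equiv.swap_apply_right, ← neg_sub]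
          exact ⟨-1, by ring⟩
        · rw [Equiv.swap_apply_of_ne_of_ne h1 h2]; simp
    have e : p * MvPolynomial.X k -
        MvPolynomial.rename (Equiv.swap i j) (p * MvPolynomial.X k) =
        (p - MvPolynomial.rename (Equiv.swap i j) p) * MvPolynomial.X k +
        MvPolynomial.rename (Equiv.swap i j) p *
          (MvPolynomial.X k - MvPolynomial.X (Equiv.swap i j k)) := by
      rw [map_mul, MvPolynomial.rename_X]; ring
    rw [e]
    exact dvd_add (hp.mul_right _) (hk.mul_left _)

/-- The divided difference `(f - s f) / (x_i - x_j)`, where `s` exchanges the variables `x_i` and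
`x_j`. It is used for `j = i + 1`; the quotient is then unique. -/
noncomputable def dividedDifference {n : ℕ} (i j : Fin n) (f : MvPolynomial (Fin n) ℤ) :
    MvPolynomial (Fin n) ℤ :=
  Classical.choose (sub_dvd_sub_rename_swap i j f)

theorem mul_dividedDifference {n : ℕ} (i j : Fin n) (f : MvPolynomial (Fin n) ℤ) :
    (MvPolynomial.X i - MvPolynomial.X j) * dividedDifference i j f =
      f - MvPolynomial.rename (Equiv.swap i j) f :=
  (Classical.choose_spec (sub_dvd_sub_rename_swap i j f)).symm

/-- `IsKeyPolynomial α κ`: the polynomial `κ` is produced from the composition `α` by the recursion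
that defines key polynomials. If `α` is weakly decreasing then `κ_α = x^α`; and if
`α_i < α_{i+1}` then `κ_α = ∂_i (x_i κ_α')`, where `α'` is `α` with the entries `i` and `i + 1`
exchanged. Any choice of the positions `i` is allowed. -/
inductive IsKeyPolynomial {n : ℕ} : (Fin n → ℕ) → MvPolynomial (Fin n) ℤ → Prop
  | of_antitone (α : Fin n → ℕ) (hα : Antitone α) :
      IsKeyPolynomial α (∏ i, MvPolynomial.X i ^ α i)
  | of_lt (α : Fin n → ℕ) (i j : Fin n) (hij : (i : ℕ) + 1 = (j : ℕ)) (hlt : α i < α j)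
      (κ : MvPolynomial (Fin n) ℤ) (hκ : IsKeyPolynomial (α ∘ Equiv.swap i j) κ) :
      IsKeyPolynomial α (dividedDifference i j (MvPolynomial.X i * κ))

/-- Every composition has a key polynomial. -/
theorem exists_isKeyPolynomial {n : ℕ} (α : Fin n → ℕ) : ∃ κ, IsKeyPolynomial α κ := by
  induction h : ∑ k : Fin n, (k : ℕ) * α k using Nat.strong_induction_on generalizing α with
  | _ m ih =>
  by_cases hα : Antitone α
  · exact ⟨_, .of_antitone α hα⟩
  · obtain ⟨i, j, hij, hlt⟩ : ∃ i j : Fin n, (i : ℕ) + 1 = (j : ℕ) ∧ α i < α j := by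
      by_contra hno
      push Not at hno
      apply hα
      cases n with
      | zero => intro a; exact a.elim0
      | succ n =>
        rw [Fin.antitone_iff_succ_le]
        intro i
        exact hno _ _ (by simp)
    have hne : i ≠ j := by
      rintro rfl
      omega
    have hd : ∑ k : Fin n, (k : ℕ) * (α ∘ Equiv.swap i j) k < m := by
      have hj : j ∈ Finset.univ.erase i := by simp [hne.symm]
      rw [← h, ← Finset.add_sum_erase Finset.univ _ (Finset.mem_univ i),
        ← Finset.add_sum_erase Finset.univ (fun k : Fin n => (k : ℕ) * α k) (Finset.mem_univ i),
        ← Finset.add_sum_erase _ _ hj,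
        ← Finset.add_sum_erase _ (fun k : Fin n => (k : ℕ) * α k) hj]
      have hr : ∑ k ∈ (Finset.univ.erase i).erase j, (k : ℕ) * (α ∘ Equiv.swap i j) k =
          ∑ k ∈ (Finset.univ.erase i).erase j, (k : ℕ) * α k := by
        refine Finset.sum_congr rfl fun k hk => ?_
        simp only [Finset.mem_erase, Finset.mem_univ, and_true] at hk
        rw [Function.comp_apply, Equiv.swap_apply_of_ne_of_ne hk.2 hk.1]
      rw [hr]
      simp only [Function.comp_apply, Equiv.swap_apply_left, Equiv.swap_apply_right, ← hij]
      nlinarith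
    obtain ⟨κ, hκ⟩ := ih _ hd _ rfl
    exact ⟨_, .of_lt α i j hij hlt κ hκ⟩

/-! ### Schubert matroids -/

/-- The Gale order: `T ≼ S` if `|T| = |S|` and, writing `T = {a₁ < ⋯ < a_k}` and
`S = {b₁ < ⋯ < b_k}`, one has `a_i ≤ b_i` for all `i`. -/
def GaleLE {n : ℕ} (T S : Finset (Fin n)) : Prop :=
  ∃ h : T.card = S.card, ∀ i : Fin S.card, T.orderEmbOfFin h i ≤ S.orderEmbOfFin rfl i

theorem galeLE_refl {n : ℕ} (S : Finset (Fin n)) : GaleLE S S :=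
  ⟨rfl, fun _ => le_rfl⟩

/-- The Gale order in terms of the numbers of elements above each threshold. -/
theorem galeLE_iff {n : ℕ} {T S : Finset (Fin n)} :
    GaleLE T S ↔ T.card = S.card ∧
      ∀ k : Fin n, (T.filter (fun x => k ≤ x)).card ≤ (S.filter (fun x => k ≤ x)).card := by
  have key : ∀ (U : Finset (Fin n)) (m : ℕ) (h : U.card = m) (k : Fin n),
      (U.filter (fun x => k ≤ x)).card =
        (Finset.univ.filter (fun i => k ≤ U.orderEmbOfFin h i)).card := by
    intro U m h k
    conv_lhs => rw [← Finset.map_orderEmbOfFin_univ U h]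
    rw [Finset.filter_map, Finset.card_map]
    rfl
  constructor
  · rintro ⟨h, hle⟩
    refine ⟨h, fun k => ?_⟩
    rw [key T _ h k, key S _ rfl k]
    refine Finset.card_le_card fun i hi => ?_
    simp only [Finset.mem_filter, Finset.mem_univ, true_and] at hi ⊢
    exact hi.trans (hle i)
  · rintro ⟨h, hc⟩
    refine ⟨h, fun i => ?_⟩
    by_contra hlt
    push Not at hlt
    have hk := hc (T.orderEmbOfFin h i)
    rw [key T _ h, key S _ rfl] at hk
    have h1 : Finset.univ.filter (fun j => T.orderEmbOfFin h i ≤ T.orderEmbOfFin h j) =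
        Finset.Ici i := by
      ext j; simp
    have h2 : Finset.univ.filter (fun j => T.orderEmbOfFin h i ≤ S.orderEmbOfFin rfl j) ⊆
        Finset.Ioi i := by
      intro j hj
      simp only [Finset.mem_filter, Finset.mem_univ, true_and] at hj
      rw [Finset.mem_Ioi]
      exact (S.orderEmbOfFin rfl).lt_iff_lt.1 (hlt.trans_le hj)
    rw [h1] at hk
    have h3 : (Finset.Ioi i).card < (Finset.Ici i).card := by
      apply Finset.card_lt_card
      rw [Finset.ssubset_iff_of_subset Finset.Ioi_subset_Ici_self]
      exact ⟨i, by simp, by simp⟩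
    have h4 := Finset.card_le_card h2
    omega

theorem galeLE_exchange {n : ℕ} {S B C : Finset (Fin n)} (hB : GaleLE B S) (hC : GaleLE C S)
    {a : Fin n} (ha : a ∈ B \ C) : ∃ b ∈ C \ B, GaleLE (insert b (B.erase a)) S := by
  rw [galeLE_iff] at hB hC
  obtain ⟨haB, haC⟩ := Finset.mem_sdiff.1 ha
  have hcard : (C \ B).card = (B \ C).card :=
    Finset.card_sdiff_comm (hC.1.trans hB.1.symm)
  have hne : (C \ B).Nonempty := by
    rw [← Finset.card_pos, hcard, Finset.card_pos]
    exact ⟨a, ha⟩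
  refine ⟨(C \ B).min' hne, Finset.min'_mem _ _, ?_⟩
  set b := (C \ B).min' hne with hbdef
  have hb : b ∈ C \ B := Finset.min'_mem _ _
  obtain ⟨hbC, hbB⟩ := Finset.mem_sdiff.1 hb
  have hmin : ∀ c ∈ C \ B, b ≤ c := fun c hc => Finset.min'_le _ _ hc
  have hbe : b ∉ B.erase a := fun h => hbB (Finset.mem_of_mem_erase h)
  rw [galeLE_iff]
  refine ⟨?_, fun k => ?_⟩
  · rw [Finset.card_insert_of_notMem hbe, Finset.card_erase_of_mem haB, ← hB.1]
    have := Finset.card_pos.2 ⟨a, haB⟩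
    omega
  · have hk := hB.2 k
    rw [Finset.filter_insert, Finset.filter_erase]
    by_cases hkb : k ≤ b
    · rw [if_pos hkb]
      by_cases hka : k ≤ a
      · refine le_trans (Finset.card_insert_le _ _) ?_
        have haf : a ∈ B.filter (fun x => k ≤ x) := Finset.mem_filter.2 ⟨haB, hka⟩
        rw [Finset.card_erase_of_mem haf]
        have := Finset.card_pos.2 ⟨a, haf⟩
        omega
      · refine le_trans (Finset.card_insert_le _ _) ?_
        refine le_trans (Nat.succ_le_succ (Finset.card_le_card (Finset.erase_subset _ _))) ?_
        refine le_trans ?_ (hC.2 k)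
        have e1 : (B.filter (fun x => k ≤ x)).card =
            ((B ∩ C).filter (fun x => k ≤ x)).card + ((B \ C).filter (fun x => k ≤ x)).card := by
          rw [← Finset.card_union_of_disjoint, ← Finset.filter_union]
          · congr 2
            ext x; simp; tauto
          · rw [Finset.disjoint_left]
            intro x; simp; tauto
        have e2 : (C.filter (fun x => k ≤ x)).card =
            ((B ∩ C).filter (fun x => k ≤ x)).card + ((C \ B).filter (fun x => k ≤ x)).card := by
          rw [← Finset.card_union_of_disjoint, ← Finset.filter_union]
          · congr 2
            ext x; simp; tauto
          · rw [Finset.disjoint_left]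
            intro x; simp; tauto
        have e3 : (C \ B).filter (fun x => k ≤ x) = C \ B :=
          Finset.filter_true_of_mem fun c hc => hkb.trans (hmin c hc)
        have e4 : ((B \ C).filter (fun x => k ≤ x)).card < (B \ C).card := by
          apply Finset.card_lt_card
          rw [Finset.ssubset_iff_of_subset (Finset.filter_subset _ _)]
          exact ⟨a, ha, fun h => hka (Finset.mem_filter.1 h).2⟩
        rw [e3] at e2
        omega
    · rw [if_neg hkb]
      exact le_trans (Finset.card_le_card (Finset.erase_subset _ _)) hk

/-- The Schubert matroid `SM_n(S)`: its bases are the sets `T ≼ S` in the Gale order. -/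
def schubertMatroid {n : ℕ} (S : Finset (Fin n)) : Matroid (Fin n) :=
  Matroid.ofIsBaseOfFinite (E := Set.univ) Set.finite_univ
    (fun B => ∃ T : Finset (Fin n), GaleLE T S ∧ (T : Set (Fin n)) = B)
    ⟨_, S, galeLE_refl S, rfl⟩
    (by
      rintro _ _ ⟨B, hB, rfl⟩ ⟨C, hC, rfl⟩ a ha
      obtain ⟨b, hb, hbS⟩ := galeLE_exchange hB hC (a := a) (by simpa using ha)
      exact ⟨b, by simpa using hb, _, hbS, by simp⟩)
    (fun _ _ => Set.subset_univ _)

/-- The matroid base polytope: the convex hull of the indicator vectors of the bases. -/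
def matroidBasePolytope {n : ℕ} (M : Matroid (Fin n)) : Set (Fin n → ℝ) :=
  convexHull ℝ {x | ∃ B, M.IsBase B ∧ x = B.indicator 1}

/-! ### Compositions -/

/-- Column `j` (for `j ≥ 1`) of the skyline diagram of `α`, which has `α i` left-justified boxes
in row `i`: the set of rows `i` with `α i ≥ j`. -/
def skylineColumn {n : ℕ} (α : Fin n → ℕ) (j : ℕ) : Finset (Fin n) :=
  Finset.univ.filter (fun i => j ≤ α i)

/-- `α` avoids the composition pattern `(0, 2)`. -/
def AvoidsZeroTwo {n : ℕ} (α : Fin n → ℕ) : Prop :=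
  ¬ ∃ i j : Fin n, i < j ∧ (2 : ℤ) ≤ (α j : ℤ) - (α i : ℤ)

/-! The Newton polytope of `κ_α` is the Minkowski sum of the base polytopes of the Schubert matroids
of the columns `D_j` (`IsKeyPolynomial.newtonPolytope_eq`). Both sides are hulls of finite sets, so
it suffices to compare maxima of linear functionals `w` with distinct entries, by induction along
the recursion. Write `π f = ∂_i (x_i f)` and `s` for the exchange of `i` and `i + 1`. If `w_i >
w_{i+1}`, top terms cannot cancel in `x_i π f - x_{i+1} π f = x_i f - x_{i+1} s f`, so `π` preserves
the maximum; replacing each column `D` by `s D` preserves the maximal weight of a basis too. If `w_i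
< w_{i+1}`, the symmetry of both sides under `s` reduces to the first case.

If `α` avoids `(0, 2)`, every coordinate is constant on all summands but at most one
(`AvoidsZeroTwo.varyDisjointly`). The sum is then a product in disjoint sets of coordinates: lattice
points multiply in every dilate, and every coordinate ranges over a unit interval, so lattice points
are vertices.

If `α_k ≥ α_i + 2` with `i < k`, the columns `α_i + 1` and `α_i + 2` both allow the move `v = e_i -
e_k` (`exists_common_move`). Applying `v` in neither, one or both columns gives three equally spaced
lattice points, the middle one not a vertex. Applying it in one column or the other gives the same
sum, so there are fewer sums of basis vectors than tuples of bases. That this contradicts the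
product formula at `t = 1` needs every lattice point of the Minkowski sum to be a sum of basis
vectors. This follows from the exchange property, which survives sums of sets
(`LoweringExchange.add`) and excludes holes (`ExchangeClosed.convexHull_inter_integerLattice`). -/

/-! ### Exchange-closed sets of integer vectors -/

/-- The one-sided exchange property: a coordinate where `y` exceeds `z` can be lowered at the
expense of raising a coordinate where `z` exceeds `y`. -/
def LoweringExchange {ι : Type*} [DecidableEq ι] (B : Set (ι → ℤ)) : Prop :=
  ∀ y ∈ B, ∀ z ∈ B, ∀ i, z i < y i →
    ∃ j, y j < z j ∧ y - Pi.single i 1 + Pi.single j 1 ∈ B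

theorem sum_natAbs_exchange_lt {ι : Type*} [Fintype ι] [DecidableEq ι] {y z : ι → ℤ} {i j : ι}
    (hi : z i < y i) (hj : y j < z j) :
    ∑ k, ((y - Pi.single i 1 + Pi.single j 1 : ι → ℤ) k - z k).natAbs < ∑ k, (y k - z k).natAbs := by
  have hij : i ≠ j := by rintro rfl; omega
  refine Finset.sum_lt_sum (fun k _ => ?_) ⟨i, Finset.mem_univ i, ?_⟩
  · by_cases h1 : k = i
    · subst h1; simp [hij]; omega
    · by_cases h2 : k = j
      · subst h2; simp [h1]; omega
      · simp [h1, h2]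
  · simp [hij]; omega

theorem loweringExchange_zero {ι : Type*} [DecidableEq ι] : LoweringExchange (0 : Set (ι → ℤ)) := by
  rintro y hy z hz i hi
  rw [Set.mem_zero] at hy hz
  simp [hy, hz] at hi

/-- Exchange inside one summand, trading `i` for some `l`. If the total at `l` now overshoots its
target, lower `l` in turn: the distance to the target pair has dropped, so the chain of exchanges
ends, and it telescopes to a single trade of `i` for `j`. -/
theorem LoweringExchange.exists_add {ι : Type*} [Fintype ι] [DecidableEq ι] (m : ℕ) :
    ∀ {B C : Set (ι → ℤ)}, LoweringExchange B → LoweringExchange C →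
    ∀ y₁ ∈ B, ∀ y₂ ∈ C, ∀ z₁ ∈ B, ∀ z₂ ∈ C, ∀ i, (z₁ + z₂) i < (y₁ + y₂) i →
      ∑ k, (y₁ k - z₁ k).natAbs + ∑ k, (y₂ k - z₂ k).natAbs ≤ m →
      ∃ j, (y₁ + y₂) j < (z₁ + z₂) j ∧ y₁ + y₂ - Pi.single i 1 + Pi.single j 1 ∈ B + C := by
  induction m with
  | zero =>
    intro B C _ _ y₁ _ y₂ _ z₁ _ z₂ _ i hi hm
    have h1 := Finset.single_le_sum (f := fun k => (y₁ k - z₁ k).natAbs)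
      (fun _ _ => Nat.zero_le _) (Finset.mem_univ i)
    have h2 := Finset.single_le_sum (f := fun k => (y₂ k - z₂ k).natAbs)
      (fun _ _ => Nat.zero_le _) (Finset.mem_univ i)
    simp only [Pi.add_apply] at hi h1 h2
    omega
  | succ m ih =>
    intro B C hB hC y₁ hy₁ y₂ hy₂ z₁ hz₁ z₂ hz₂ i hi hm
    wlog h : z₁ i < y₁ i generalizing B C y₁ y₂ z₁ z₂
    · have h' : z₂ i < y₂ i := by
        simp only [Pi.add_apply] at hi; omega
      rw [add_comm y₁, add_comm z₁, add_comm B]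
      exact this hC hB y₂ hy₂ y₁ hy₁ z₂ hz₂ z₁ hz₁ (by rwa [add_comm z₂, add_comm y₂])
        (by omega) h'
    obtain ⟨l, hl, hlB⟩ := hB y₁ hy₁ z₁ hz₁ i h
    have hil : i ≠ l := by rintro rfl; omega
    have e : y₁ + y₂ - Pi.single i 1 + Pi.single l 1 =
        (y₁ - Pi.single i 1 + Pi.single l 1) + y₂ := by abel
    by_cases hl' : (y₁ + y₂) l < (z₁ + z₂) l
    · exact ⟨l, hl', e ▸ Set.add_mem_add hlB hy₂⟩
    have hd := sum_natAbs_exchange_lt h hl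
    obtain ⟨j, hj, hjB⟩ := ih hB hC _ hlB y₂ hy₂ z₁ hz₁ z₂ hz₂ l (by
      -- Since `l` was not below its target before the exchange, it is strictly above it afterwards.
      simp [hil.symm] at hl' ⊢; omega) (by omega)
    refine ⟨j, ?_, ?_⟩
    · by_cases hjl : j = l
      · subst hjl; simp [hil.symm] at hj hl' ⊢; omega
      · by_cases hji : j = i
        · subst hji; simp [hil] at hj hi ⊢; omega
        · simpa [hjl, hji] using hj
    · have e' : y₁ + y₂ - Pi.single i 1 + Pi.single j 1 =
        (y₁ - Pi.single i 1 + Pi.single l 1) + y₂ - Pi.single l 1 + Pi.single j 1 := by abel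
      rwa [e']

theorem LoweringExchange.add {ι : Type*} [Fintype ι] [DecidableEq ι] {B C : Set (ι → ℤ)}
    (hB : LoweringExchange B) (hC : LoweringExchange C) : LoweringExchange (B + C) := by
  rintro _ ⟨y₁, hy₁, y₂, hy₂, rfl⟩ _ ⟨z₁, hz₁, z₂, hz₂, rfl⟩ i hi
  exact LoweringExchange.exists_add _ hB hC y₁ hy₁ y₂ hy₂ z₁ hz₁ z₂ hz₂ i hi le_rfl

theorem LoweringExchange.sum {ι κ : Type*} [Fintype ι] [DecidableEq ι] {s : Finset κ}
    {B : κ → Set (ι → ℤ)} (h : ∀ k ∈ s, LoweringExchange (B k)) :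
    LoweringExchange (∑ k ∈ s, B k) :=
  Finset.sum_induction B LoweringExchange (fun _ _ => LoweringExchange.add)
    loweringExchange_zero h

/-- The exchange property in both directions. -/
structure ExchangeClosed {ι : Type*} [DecidableEq ι] (B : Set (ι → ℤ)) : Prop where
  lower : LoweringExchange B
  lower_neg : LoweringExchange (-B)

theorem ExchangeClosed.sum {ι κ : Type*} [Fintype ι] [DecidableEq ι] {s : Finset κ}
    {B : κ → Set (ι → ℤ)} (h : ∀ k ∈ s, ExchangeClosed (B k)) :
    ExchangeClosed (∑ k ∈ s, B k) :=
  ⟨.sum fun k hk => (h k hk).lower, by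
    rw [← Finset.sum_neg_distrib]
    exact .sum fun k hk => (h k hk).lower_neg⟩

theorem ExchangeClosed.raise {ι : Type*} [DecidableEq ι] {B : Set (ι → ℤ)}
    (hB : ExchangeClosed B) {y z : ι → ℤ} (hy : y ∈ B) (hz : z ∈ B) {j : ι} (hj : y j < z j) :
    ∃ i, z i < y i ∧ y - Pi.single i 1 + Pi.single j 1 ∈ B := by
  obtain ⟨i, hi, h⟩ := hB.lower_neg (-y) (by simpa) (-z) (by simpa) j (by simpa)
  refine ⟨i, by simpa using hi, ?_⟩
  rw [Set.mem_neg] at h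
  convert h using 1
  abel

/-- If no exchange moves a unit of `y` out of `J`, then `y` has the least total on `J`. -/
theorem ExchangeClosed.sum_le_of_no_exchange {ι : Type*} [Fintype ι] [DecidableEq ι]
    {B : Set (ι → ℤ)} (hB : ExchangeClosed B) {J : Finset ι} {z : ι → ℤ} (hz : z ∈ B) (m : ℕ) :
    ∀ y ∈ B, ∑ k, (y k - z k).natAbs ≤ m →
      (∀ a ∈ J, ∀ b ∉ J, y - Pi.single a 1 + Pi.single b 1 ∉ B) →
      ∑ k ∈ J, y k ≤ ∑ k ∈ J, z k := by
  induction m with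
  | zero =>
    intro y _ hm _
    refine Finset.sum_le_sum fun k _ => ?_
    have h1 := Finset.single_le_sum (f := fun k => (y k - z k).natAbs)
      (fun _ _ => Nat.zero_le _) (Finset.mem_univ k)
    omega
  | succ m ih =>
    intro y hy hm hJ
    by_contra! hlt
    obtain ⟨l, hlJ, hl⟩ := Finset.exists_lt_of_sum_lt hlt
    obtain ⟨j, hj, hjB⟩ := hB.lower y hy z hz l hl
    have hjJ : j ∈ J := by
      by_contra hjJ
      exact hJ l hlJ j hjJ hjB
    have hd := sum_natAbs_exchange_lt hl hj
    have hlj : l ≠ j := by rintro rfl; omega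
    -- The new vector has the same total on `J` and is closer to `z`. It also admits no exchange out
    -- of `J`: raising `y` at `b` towards such an exchange `w` would lower `l` or `a`, both in `J`,
    -- and thus give a forbidden exchange from `y`.
    have := ih _ hjB (by omega) (by
      intro a ha b hb hw
      have hbl : b ≠ l := by rintro rfl; exact hb hlJ
      have hbj : b ≠ j := by rintro rfl; exact hb hjJ
      have hba : b ≠ a := by rintro rfl; exact hb ha
      obtain ⟨i, hi, hiB⟩ := hB.raise hy hw (j := b) (by simp [hbl, hbj, hba])
      refine hJ i ?_ b hb hiB
      by_contra hiJ
      have h1 : i ≠ l := by rintro rfl; exact hiJ hlJ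
      have h2 : i ≠ a := by rintro rfl; exact hiJ ha
      simp only [Pi.add_apply, Pi.sub_apply, Pi.single_apply, h1, h2, if_false] at hi
      split_ifs at hi <;> omega)
    have e : ∑ k ∈ J, (y - Pi.single l 1 + Pi.single j 1 : ι → ℤ) k = ∑ k ∈ J, y k := by
      simp [Finset.sum_add_distrib, Finset.sum_sub_distrib, Finset.sum_pi_single', hlJ, hjJ]
    omega

/-- Raise the first vector at `j` towards the second: `l` is the only coordinate where the first
exceeds the second, so the unit must come from `l`. -/
theorem ExchangeClosed.exchange_trans {ι : Type*} [DecidableEq ι] {B : Set (ι → ℤ)}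
    (hB : ExchangeClosed B) {y : ι → ℤ} {i l j : ι} (hjl : j ≠ l) (hji : j ≠ i)
    (h₁ : y - Pi.single i 1 + Pi.single l 1 ∈ B) (h₂ : y - Pi.single l 1 + Pi.single j 1 ∈ B) :
    y - Pi.single i 1 + Pi.single j 1 ∈ B := by
  by_cases hil : i = l
  · subst hil; exact h₂
  obtain ⟨a, ha, haB⟩ := hB.raise h₁ h₂ (j := j) (by simp [hjl, hji])
  have hal : a = l := by
    by_contra hal
    simp only [Pi.add_apply, Pi.sub_apply, Pi.single_apply, hal, if_false] at ha
    split_ifs at ha <;> omega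
  subst hal
  convert haB using 1
  abel

/-- An exchange-closed set contains every integer vector `x` which, on every set of coordinates,
has total at least the minimum over `B`. -/
theorem ExchangeClosed.mem_of_sum_le {ι : Type*} [Fintype ι] [DecidableEq ι]
    {B : Set (ι → ℤ)} (hB : ExchangeClosed B) {x : ι → ℤ}
    (hx : ∀ (J : Finset ι) (c : ℤ), (∀ z ∈ B, c ≤ ∑ k ∈ J, z k) → c ≤ ∑ k ∈ J, x k)
    (hx' : ∀ (c : ℤ), (∀ z ∈ B, ∑ k, z k ≤ c) → ∑ k, x k ≤ c) (m : ℕ) :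
    ∀ y ∈ B, ∑ k, (y k - x k).natAbs ≤ m → x ∈ B := by
  classical
  induction m with
  | zero =>
    intro y hy hm
    convert hy
    ext k
    have h1 := Finset.single_le_sum (f := fun k => (y k - x k).natAbs)
      (fun _ _ => Nat.zero_le _) (Finset.mem_univ k)
    omega
  | succ m ih =>
    intro y hy hm
    by_cases hyx : ∃ i, x i < y i
    · obtain ⟨i, hi⟩ := hyx
      -- `J` collects the coordinates that can receive a unit from `i`. By transitivity no exchange
      -- leaves `J`, so `y` is minimal on `J`; as `x i < y i`, some other coordinate of `J` must be
      -- raised to reach `x`.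
      let J : Finset ι := Finset.univ.filter
        fun j => j = i ∨ y - Pi.single i 1 + Pi.single j 1 ∈ B
      have hJ : ∀ a ∈ J, ∀ b ∉ J, y - Pi.single a 1 + Pi.single b 1 ∉ B := by
        intro a ha b hb hab
        simp only [J, Finset.mem_filter, Finset.mem_univ, true_and, not_or] at ha hb
        rcases ha with rfl | ha
        · exact hb.2 hab
        · by_cases hba : b = a
          · subst hba; exact hb.2 ha
          · exact hb.2 (hB.exchange_trans hba hb.1 ha hab)
      have hle := hx J _ fun z hz => hB.sum_le_of_no_exchange hz _ y hy le_rfl hJ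
      obtain ⟨j, hjJ, hj⟩ : ∃ j ∈ J, y j < x j := by
        by_contra! hno
        exact absurd hle (not_le.2 (Finset.sum_lt_sum hno ⟨i, by simp [J], hi⟩))
      have hjB : y - Pi.single i 1 + Pi.single j 1 ∈ B := by
        simp only [J, Finset.mem_filter, Finset.mem_univ, true_and] at hjJ
        rcases hjJ with rfl | h
        · omega
        · exact h
      have := sum_natAbs_exchange_lt hi hj
      exact ih _ hjB (by omega)
    · push Not at hyx
      -- All members of `B` have the same total, so `y ≤ x` together with the upper bound on the
      -- total of `x` forces equality.
      have hle := hx' (∑ k, y k) fun z hz => by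
        simpa using hB.sum_le_of_no_exchange (J := Finset.univ) hy _ z hz le_rfl (by simp)
      have heq := (Finset.sum_eq_sum_iff_of_le (s := Finset.univ) fun k _ => hyx k).1
        (le_antisymm (Finset.sum_le_sum fun k _ => hyx k) hle)
      convert hy
      ext k
      exact (heq k (Finset.mem_univ k)).symm

/-- The inclusion of integer vectors into real vectors. -/
def intVec {ι : Type*} : (ι → ℤ) →+ (ι → ℝ) where
  toFun x i := x i
  map_zero' := by ext; simp
  map_add' x y := by ext; simp

@[simp]
theorem intVec_apply {ι : Type*} (x : ι → ℤ) (i : ι) : intVec x i = x i := rfl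

theorem intVec_injective {ι : Type*} : Function.Injective (intVec (ι := ι)) := by
  intro x y h
  ext i
  have := congrFun h i
  simpa using this

theorem intVec_mem_integerLattice {n : ℕ} (x : Fin n → ℤ) : intVec x ∈ integerLattice n :=
  fun i => ⟨x i, rfl⟩

theorem exists_intVec_eq {n : ℕ} {x : Fin n → ℝ} (hx : x ∈ integerLattice n) :
    ∃ y, intVec y = x := by
  choose y hy using hx
  exact ⟨y, funext fun i => (hy i).symm⟩

/-- An exchange-closed set has no holes. -/
theorem ExchangeClosed.convexHull_inter_integerLattice {n : ℕ} {B : Set (Fin n → ℤ)}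
    (hB : ExchangeClosed B) :
    convexHull ℝ (intVec '' B) ∩ integerLattice n = intVec '' B := by
  refine Set.Subset.antisymm ?_ ?_
  · rintro x ⟨hx, hxZ⟩
    obtain ⟨x, rfl⟩ := exists_intVec_eq hxZ
    refine ⟨x, ?_, rfl⟩
    have hne : B.Nonempty := by
      have := (convexHull_nonempty_iff (𝕜 := ℝ)).1 ⟨_, hx⟩
      simpa using this
    obtain ⟨y, hy⟩ := hne
    have hlin : ∀ J : Finset (Fin n), IsLinearMap ℝ fun x : Fin n → ℝ => ∑ k ∈ J, x k := by
      intro J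
      refine ⟨fun x y => ?_, fun c x => ?_⟩
      · simp [Finset.sum_add_distrib]
      · simp [Finset.mul_sum]
    refine hB.mem_of_sum_le ?_ ?_ _ y hy le_rfl
    · intro J c hc
      have h : convexHull ℝ (intVec '' B) ⊆ {x | (c : ℝ) ≤ ∑ k ∈ J, x k} := by
        refine convexHull_min ?_ (convex_halfSpace_ge (hlin J) _)
        rintro _ ⟨z, hz, rfl⟩
        have := hc z hz
        simp only [Set.mem_ofPred_eq, intVec_apply]
        exact_mod_cast this
      have := h hx
      simp only [Set.mem_ofPred_eq, intVec_apply] at this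
      exact_mod_cast this
    · intro c hc
      have h : convexHull ℝ (intVec '' B) ⊆ {x | ∑ k, x k ≤ (c : ℝ)} := by
        refine convexHull_min ?_ (convex_halfSpace_le (hlin Finset.univ) _)
        rintro _ ⟨z, hz, rfl⟩
        have := hc z hz
        simp only [Set.mem_ofPred_eq, intVec_apply]
        exact_mod_cast this
      have := h hx
      simp only [Set.mem_ofPred_eq, intVec_apply] at this
      exact_mod_cast this
  · rintro _ ⟨x, hx, rfl⟩
    exact ⟨subset_convexHull ℝ _ ⟨x, hx, rfl⟩, intVec_mem_integerLattice x⟩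

/-! ### The Gale order -/

/-- The number of elements of `T` that are at least `k`. -/
def countGE {n : ℕ} (T : Finset (Fin n)) (k : ℕ) : ℕ :=
  (T.filter fun x : Fin n => k ≤ (x : ℕ)).card

theorem countGE_eq {n : ℕ} (T : Finset (Fin n)) (i : Fin n) :
    countGE T i = countGE T (i + 1) + if i ∈ T then 1 else 0 := by
  have e : T.filter (fun x : Fin n => (i : ℕ) ≤ (x : ℕ)) =
      T.filter (fun x : Fin n => (i : ℕ) + 1 ≤ (x : ℕ)) ∪ T.filter (fun x : Fin n => x = i) := by
    ext x
    simp only [Finset.mem_filter, Finset.mem_union, Fin.ext_iff]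
    rw [← and_or_left]
    exact and_congr_right fun _ => by omega
  have hd : Disjoint (T.filter (fun x : Fin n => (i : ℕ) + 1 ≤ (x : ℕ))) (T.filter (fun x : Fin n => x = i)) := by
    rw [Finset.disjoint_filter]
    rintro x _ h rfl
    omega
  rw [countGE, e, Finset.card_union_of_disjoint hd, countGE, Finset.filter_eq']
  split_ifs <;> simp

/-- Natural-number thresholds make `j + 1` available even for the last index `j`. The exchange of
adjacent `i` and `j` changes only the count at threshold `j`, so the lemmas on `swapSet` need only
that one comparison. -/
theorem galeLE_iff_countGE {n : ℕ} {T S : Finset (Fin n)} :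
    GaleLE T S ↔ T.card = S.card ∧ ∀ k, countGE T k ≤ countGE S k := by
  rw [galeLE_iff]
  refine and_congr_right fun _ => ⟨fun h k => ?_, fun h k => h k⟩
  by_cases hk : k < n
  · exact h ⟨k, hk⟩
  · have : T.filter (fun x : Fin n => k ≤ (x : ℕ)) = ∅ :=
      Finset.filter_eq_empty_iff.2 fun x _ => by omega
    rw [countGE, this]
    simp

theorem GaleLE.trans {n : ℕ} {T S U : Finset (Fin n)} (h₁ : GaleLE T S) (h₂ : GaleLE S U) :
    GaleLE T U := by
  rw [galeLE_iff_countGE] at *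
  exact ⟨h₁.1.trans h₂.1, fun k => (h₁.2 k).trans (h₂.2 k)⟩

/-- The image of a finite set under the transposition of `i` and `j`. -/
def swapSet {n : ℕ} (i j : Fin n) (T : Finset (Fin n)) : Finset (Fin n) :=
  T.map (Equiv.swap i j).toEmbedding

@[simp]
theorem mem_swapSet {n : ℕ} {i j x : Fin n} {T : Finset (Fin n)} :
    x ∈ swapSet i j T ↔ Equiv.swap i j x ∈ T := by
  rw [swapSet, Finset.mem_map_equiv, Equiv.symm_swap]

@[simp]
theorem card_swapSet {n : ℕ} (i j : Fin n) (T : Finset (Fin n)) :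
    (swapSet i j T).card = T.card :=
  Finset.card_map _

@[simp]
theorem swapSet_swapSet {n : ℕ} (i j : Fin n) (T : Finset (Fin n)) :
    swapSet i j (swapSet i j T) = T := by
  ext; simp

theorem swapSet_eq_self {n : ℕ} {i j : Fin n} {T : Finset (Fin n)} (h : i ∈ T ↔ j ∈ T) :
    swapSet i j T = T := by
  ext x
  rw [mem_swapSet]
  by_cases h1 : x = i
  · subst h1; simp [h]
  · by_cases h2 : x = j
    · subst h2; simp [h]
    · rw [Equiv.swap_apply_of_ne_of_ne h1 h2]

theorem countGE_swapSet_of_ne {n : ℕ} {i j : Fin n} (hij : (i : ℕ) + 1 = j) (T : Finset (Fin n))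
    {k : ℕ} (hk : k ≠ j) : countGE (swapSet i j T) k = countGE T k := by
  rw [countGE, countGE, swapSet, Finset.filter_map, Finset.card_map]
  congr 1
  refine Finset.filter_congr fun x _ => ?_
  simp only [Function.comp_apply, Equiv.toEmbedding_apply]
  by_cases h1 : x = i
  · subst h1; rw [Equiv.swap_apply_left]; omega
  · by_cases h2 : x = j
    · subst h2; rw [Equiv.swap_apply_right]; omega
    · rw [Equiv.swap_apply_of_ne_of_ne h1 h2]

theorem countGE_swapSet {n : ℕ} {i j : Fin n} (hij : (i : ℕ) + 1 = j) (T : Finset (Fin n)) :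
    countGE (swapSet i j T) j = countGE T (j + 1) + if i ∈ T then 1 else 0 := by
  rw [countGE_eq, countGE_swapSet_of_ne hij T (by omega)]
  simp

theorem galeLE_swapSet_of_mem {n : ℕ} {i j : Fin n} (hij : (i : ℕ) + 1 = j)
    {T D : Finset (Fin n)} (hi : i ∉ T) (h : GaleLE T D) :
    GaleLE (swapSet i j T) D := by
  rw [galeLE_iff_countGE] at *
  refine ⟨by simpa using h.1, fun k => ?_⟩
  by_cases hk : k = j
  · subst hk
    have h1 := h.2 (j + 1)
    rw [countGE_swapSet hij, if_neg hi, countGE_eq D j]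
    omega
  · rw [countGE_swapSet_of_ne hij T hk]; exact h.2 k

theorem galeLE_swapSet_of_imp {n : ℕ} {i j : Fin n} (hij : (i : ℕ) + 1 = j)
    {T D : Finset (Fin n)} (hD : i ∈ D → j ∈ D) (h : GaleLE T D) :
    GaleLE (swapSet i j T) D := by
  rw [galeLE_iff_countGE] at *
  refine ⟨by simpa using h.1, fun k => ?_⟩
  by_cases hk : k = j
  · subst hk
    have h1 := h.2 (j + 1)
    have h2 := h.2 i
    rw [countGE_eq T i, countGE_eq D i, hij, countGE_eq T j, countGE_eq D j] at h2
    rw [countGE_swapSet hij, countGE_eq D j]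
    split_ifs at * <;> first | omega | tauto
  · rw [countGE_swapSet_of_ne hij T hk]; exact h.2 k

theorem galeLE_swapSet_right {n : ℕ} {i j : Fin n} (hij : (i : ℕ) + 1 = j)
    {T D : Finset (Fin n)} (hi : i ∉ D) (hT : j ∈ T → i ∈ T) (h : GaleLE T D) :
    GaleLE T (swapSet i j D) := by
  rw [galeLE_iff_countGE] at *
  refine ⟨by simpa using h.1, fun k => ?_⟩
  by_cases hk : k = j
  · subst hk
    have h1 := h.2 (j + 1)
    have h2 := h.2 i
    rw [countGE_eq T i, countGE_eq D i, hij, countGE_eq T j, countGE_eq D j] at h2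
    rw [countGE_swapSet hij, countGE_eq T j]
    split_ifs at * <;> first | omega | tauto
  · rw [countGE_swapSet_of_ne hij D hk]; exact h.2 k

theorem swapSet_galeLE_swapSet {n : ℕ} {i j : Fin n} (hij : (i : ℕ) + 1 = j)
    {T D : Finset (Fin n)} (hi : i ∉ T) (h : GaleLE T D) :
    GaleLE (swapSet i j T) (swapSet i j D) := by
  rw [galeLE_iff_countGE] at *
  refine ⟨by simpa using h.1, fun k => ?_⟩
  by_cases hk : k = j
  · subst hk
    have h1 := h.2 (j + 1)
    rw [countGE_swapSet hij, countGE_swapSet hij, if_neg hi]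
    omega
  · rw [countGE_swapSet_of_ne hij _ hk, countGE_swapSet_of_ne hij _ hk]; exact h.2 k

/-- Replacing an element by a smaller one decreases in the Gale order. -/
theorem galeLE_insert_erase {n : ℕ} {D : Finset (Fin n)} {i k : Fin n} (hik : i < k)
    (hi : i ∉ D) (hk : k ∈ D) : GaleLE (insert i (D.erase k)) D := by
  have hie : i ∉ D.erase k := fun h => hi (Finset.mem_of_mem_erase h)
  have hpos := Finset.card_pos.2 ⟨k, hk⟩
  rw [galeLE_iff]
  refine ⟨?_, fun m => ?_⟩
  · rw [Finset.card_insert_of_notMem hie, Finset.card_erase_of_mem hk]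
    omega
  · rw [Finset.filter_insert, Finset.filter_erase]
    split_ifs with hm
    · refine (Finset.card_insert_le _ _).trans ?_
      have hkf : k ∈ D.filter (fun x => m ≤ x) := Finset.mem_filter.2 ⟨hk, hm.trans hik.le⟩
      rw [Finset.card_erase_of_mem hkf]
      have := Finset.card_pos.2 ⟨k, hkf⟩
      omega
    · exact Finset.card_le_card (Finset.erase_subset _ _)

/-- If all elements up to `i` belong to `D`, then `i` belongs to every `T ≼ D`. -/
theorem GaleLE.mem_of_forall_le {n : ℕ} {T D : Finset (Fin n)} (h : GaleLE T D) {i : Fin n}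
    (hD : ∀ a ≤ i, a ∈ D) : i ∈ T := by
  rw [galeLE_iff_countGE] at h
  by_contra hi
  have h1 := h.2 (i + 1)
  have key : ∀ U : Finset (Fin n),
      countGE U (i + 1) + (U.filter fun x => x ≤ i).card = U.card := by
    intro U
    rw [countGE, ← Finset.card_filter_add_card_filter_not (s := U)
      (fun x : Fin n => (i : ℕ) + 1 ≤ x)]
    congr 2
    refine Finset.filter_congr fun x _ => ?_
    rw [Fin.le_def]
    omega
  have h2 := key T
  have h3 := key D
  have h4 : (T.filter fun x => x ≤ i).card < (D.filter fun x => x ≤ i).card := by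
    apply Finset.card_lt_card
    rw [Finset.ssubset_iff_of_subset]
    · exact ⟨i, by simp [hD i le_rfl], by simp [hi]⟩
    · intro x hx
      rw [Finset.mem_filter] at hx ⊢
      exact ⟨hD x hx.2, hx.2⟩
  have := h.1
  omega

/-- If no element from `i` on belongs to `D`, then `i` belongs to no `T ≼ D`. -/
theorem GaleLE.notMem_of_forall_ge {n : ℕ} {T D : Finset (Fin n)} (h : GaleLE T D) {i : Fin n}
    (hD : ∀ b, i ≤ b → b ∉ D) : i ∉ T := by
  intro hi
  have h1 := (galeLE_iff.1 h).2 i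
  have h2 : D.filter (fun x => i ≤ x) = ∅ :=
    Finset.filter_eq_empty_iff.2 fun x hx hix => hD x hix hx
  rw [h2, Finset.card_empty, Nat.le_zero, Finset.card_eq_zero] at h1
  exact Finset.eq_empty_iff_forall_notMem.1 h1 i (by simp [hi])

/-! ### Indicator vectors of the bases of Schubert matroids -/

/-- The integer indicator vector of a finite set. -/
def indVec {n : ℕ} (T : Finset (Fin n)) (i : Fin n) : ℤ := if i ∈ T then 1 else 0

/-- The indicator vectors of the sets `T ≼ S`. -/
def galeVectors {n : ℕ} (S : Finset (Fin n)) : Set (Fin n → ℤ) :=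
  indVec '' {T | GaleLE T S}

theorem finite_galeVectors {n : ℕ} (S : Finset (Fin n)) : (galeVectors S).Finite :=
  (Set.toFinite _).image _

theorem schubertMatroid_isBase {n : ℕ} (S T : Finset (Fin n)) :
    (schubertMatroid S).IsBase T ↔ GaleLE T S := by
  have h : (schubertMatroid S).IsBase T ↔
    ∃ U : Finset (Fin n), GaleLE U S ∧ (U : Set (Fin n)) = T := Iff.rfl
  simpa using h

theorem matroidBasePolytope_schubertMatroid {n : ℕ} (S : Finset (Fin n)) :
    matroidBasePolytope (schubertMatroid S) = convexHull ℝ (intVec '' galeVectors S) := by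
  have e : ∀ T : Finset (Fin n),
      (T : Set (Fin n)).indicator (1 : Fin n → ℝ) = intVec (indVec T) := by
    intro T
    ext i
    by_cases hi : i ∈ T <;> simp [indVec, hi]
  rw [matroidBasePolytope]
  congr 1
  ext x
  simp only [galeVectors, Set.mem_image, Set.mem_ofPred_eq, exists_exists_and_eq_and]
  constructor
  · rintro ⟨B, hB, rfl⟩
    lift B to Finset (Fin n) using Set.toFinite B
    exact ⟨B, (schubertMatroid_isBase S B).1 hB, (e B).symm⟩
  · rintro ⟨T, hT, rfl⟩
    exact ⟨T, (schubertMatroid_isBase S T).2 hT, (e T).symm⟩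

/-- This is basis exchange in the dual matroid, read on complements. -/
theorem galeLE_rev_exchange {n : ℕ} {S B C : Finset (Fin n)} (hB : GaleLE B S) (hC : GaleLE C S)
    {b : Fin n} (hb : b ∈ C \ B) : ∃ a ∈ B \ C, GaleLE (insert b (B.erase a)) S := by
  rw [← schubertMatroid_isBase] at hB hC
  obtain ⟨hbC, hbB⟩ := Finset.mem_sdiff.1 hb
  have hE : (schubertMatroid S).E = Set.univ := rfl
  have hB' := hB.compl_isBase_dual
  have hC' := hC.compl_isBase_dual
  rw [hE] at hB' hC'
  obtain ⟨a, ha, hbase⟩ := hB'.exchange hC' (e := b) (by simp [hbC, hbB])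
  simp only [Set.mem_sdiff, Set.mem_univ, true_and, Finset.mem_coe, not_not] at ha
  refine ⟨a, by simp [ha], ?_⟩
  rw [← schubertMatroid_isBase]
  have h := hbase.compl_isBase_of_dual
  rw [hE] at h
  convert h using 1
  have hab : a ≠ b := by rintro rfl; exact hbB ha.2
  ext x
  by_cases h1 : x = a
  · subst h1; simp [hab]
  · by_cases h2 : x = b
    · subst h2; simp [h1]
    · simp [h1, h2]

theorem indVec_insert_erase {n : ℕ} {B : Finset (Fin n)} {a b : Fin n} (ha : a ∈ B) (hb : b ∉ B) :
    indVec (insert b (B.erase a)) = indVec B - Pi.single a 1 + Pi.single b 1 := by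
  have hab : a ≠ b := by rintro rfl; exact hb ha
  ext x
  by_cases h1 : x = a
  · subst h1; simp [indVec, hab, ha]
  · by_cases h2 : x = b
    · subst h2; simp [indVec, hb, h1]
    · simp [indVec, h1, h2]

theorem indVec_lt_indVec {n : ℕ} {B C : Finset (Fin n)} {i : Fin n} :
    indVec C i < indVec B i ↔ i ∈ B \ C := by
  by_cases h1 : i ∈ B <;> by_cases h2 : i ∈ C <;> simp [indVec, h1, h2]

theorem exchangeClosed_galeVectors {n : ℕ} (S : Finset (Fin n)) :
    ExchangeClosed (galeVectors S) := by
  constructor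
  · rintro _ ⟨B, hB, rfl⟩ _ ⟨C, hC, rfl⟩ a ha
    rw [indVec_lt_indVec] at ha
    obtain ⟨b, hb, h⟩ := galeLE_exchange hB hC ha
    exact ⟨b, indVec_lt_indVec.2 hb, _, h,
      indVec_insert_erase (Finset.mem_sdiff.1 ha).1 (Finset.mem_sdiff.1 hb).2⟩
  · rintro y ⟨B, hB, hy⟩ z ⟨C, hC, hz⟩ b hb
    obtain rfl : y = -indVec B := by rw [hy, neg_neg]
    obtain rfl : z = -indVec C := by rw [hz, neg_neg]
    rw [Pi.neg_apply, Pi.neg_apply, neg_lt_neg_iff, indVec_lt_indVec] at hb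
    obtain ⟨a, ha, h⟩ := galeLE_rev_exchange hB hC hb
    refine ⟨a, ?_, _, h, ?_⟩
    · rw [Pi.neg_apply, Pi.neg_apply, neg_lt_neg_iff, indVec_lt_indVec]
      exact ha
    · rw [indVec_insert_erase (Finset.mem_sdiff.1 ha).1 (Finset.mem_sdiff.1 hb).2]
      abel

/-! ### The sums of indicator vectors over the columns of a skyline diagram -/

/-- The sums of indicator vectors of bases, one for each of the first `N` columns. -/
def columnSums {n : ℕ} (N : ℕ) (α : Fin n → ℕ) : Set (Fin n → ℤ) :=
  ∑ j ∈ Finset.Icc 1 N, galeVectors (skylineColumn α j)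

theorem exchangeClosed_columnSums {n : ℕ} (N : ℕ) (α : Fin n → ℕ) :
    ExchangeClosed (columnSums N α) :=
  .sum fun _ _ => exchangeClosed_galeVectors _

theorem mem_columnSums {n N : ℕ} {α : Fin n → ℕ} {x : Fin n → ℤ} :
    x ∈ columnSums N α ↔ ∃ T : ℕ → Finset (Fin n),
      (∀ j ∈ Finset.Icc 1 N, GaleLE (T j) (skylineColumn α j)) ∧
        x = ∑ j ∈ Finset.Icc 1 N, indVec (T j) := by
  rw [columnSums, Set.mem_finsetSum]
  constructor
  · rintro ⟨g, hg, rfl⟩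
    have : ∀ j, ∃ T, j ∈ Finset.Icc 1 N → GaleLE T (skylineColumn α j) ∧ indVec T = g j := by
      intro j
      by_cases hj : j ∈ Finset.Icc 1 N
      · obtain ⟨T, hT, h⟩ := hg hj
        exact ⟨T, fun _ => ⟨hT, h⟩⟩
      · exact ⟨∅, fun h => absurd h hj⟩
    choose T hT using this
    exact ⟨T, fun j hj => (hT j hj).1, Finset.sum_congr rfl fun j hj => (hT j hj).2.symm⟩
  · rintro ⟨T, hT, rfl⟩
    exact ⟨fun j => indVec (T j), fun {j} hj => ⟨T j, hT j hj, rfl⟩, rfl⟩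

theorem finite_columnSums {n : ℕ} (N : ℕ) (α : Fin n → ℕ) : (columnSums N α).Finite := by
  rw [columnSums]
  exact Finset.sum_induction _ Set.Finite (fun _ _ => Set.Finite.add) Set.finite_zero
    fun j _ => finite_galeVectors _

theorem convexHull_columnSums {n : ℕ} (N : ℕ) (α : Fin n → ℕ) :
    convexHull ℝ (intVec '' columnSums N α) =
      ∑ j ∈ Finset.Icc 1 N, convexHull ℝ (intVec '' galeVectors (skylineColumn α j)) := by
  rw [columnSums, Set.image_finsetSum, convexHull_sum]

@[simp]
theorem mem_skylineColumn {n : ℕ} {α : Fin n → ℕ} {j : ℕ} {i : Fin n} :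
    i ∈ skylineColumn α j ↔ j ≤ α i := by
  simp [skylineColumn]

theorem skylineColumn_comp_swap {n : ℕ} (α : Fin n → ℕ) (i k : Fin n) (j : ℕ) :
    skylineColumn (α ∘ Equiv.swap i k) j = swapSet i k (skylineColumn α j) := by
  ext; simp

theorem sum_indVec_skylineColumn {n N : ℕ} {α : Fin n → ℕ} (hN : ∀ i, α i ≤ N) :
    ∑ j ∈ Finset.Icc 1 N, indVec (skylineColumn α j) = fun i => (α i : ℤ) := by
  ext i
  simp only [Finset.sum_apply, indVec, mem_skylineColumn]
  rw [← Finset.sum_filter, Finset.sum_const, nsmul_eq_mul, mul_one]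
  have : (Finset.Icc 1 N).filter (fun j => j ≤ α i) = Finset.Icc 1 (α i) := by
    ext j
    have := hN i
    simp only [Finset.mem_filter, Finset.mem_Icc]
    omega
  rw [this]
  simp

/-! ### Comparison of convex hulls through generic linear functionals -/

/-- Each pair of distinct indices excludes at most one value of `ε`. -/
theorem eventually_injective_add_smul {n : ℕ} (w : Fin n → ℝ) :
    ∀ᶠ ε : ℝ in nhdsWithin 0 (Set.Ioi 0),
      Function.Injective fun i : Fin n => w i + ε * (i : ℕ) := by
  have h : ∀ p : Fin n × Fin n, ∀ᶠ ε : ℝ in nhdsWithin 0 (Set.Ioi 0),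
      w p.1 + ε * (p.1 : ℕ) = w p.2 + ε * (p.2 : ℕ) → p.1 = p.2 := by
    rintro ⟨i, j⟩
    by_cases hij : i = j
    · exact Filter.Eventually.of_forall fun _ _ => hij
    have hne : ((i : ℕ) : ℝ) - (j : ℕ) ≠ 0 := by
      rw [sub_ne_zero]
      exact_mod_cast fun h => hij (Fin.ext h)
    -- The excluded value may be `0` itself; adjoining `0` keeps this a neighbourhood, and `ε > 0`
    -- removes it again.
    have hcompl : ({(w j - w i) / ((i : ℕ) - (j : ℕ))} : Set ℝ)ᶜ ∪ {0} ∈ nhds (0 : ℝ) := by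
      by_cases h0 : (w j - w i) / ((i : ℕ) - (j : ℕ)) = (0 : ℝ)
      · rw [h0, Set.compl_union_self]; exact Filter.univ_mem
      · exact Filter.mem_of_superset (isOpen_compl_singleton.mem_nhds (Ne.symm h0))
          Set.subset_union_left
    filter_upwards [mem_nhdsWithin_of_mem_nhds hcompl, self_mem_nhdsWithin] with ε hε hpos heq
    exfalso
    rcases hε with hε | hε
    · apply hε
      rw [Set.mem_singleton_iff, eq_div_iff hne]
      linarith
    · exact (ne_of_gt hpos) hε
  filter_upwards [Filter.eventually_all.2 h] with ε hε i j hij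
  exact hε (i, j) hij

/-- To compare the convex hulls of two sets, the second one finite, it suffices to compare the
values of linear functionals with pairwise distinct coefficients. -/
theorem convexHull_subset_of_forall_injective {n : ℕ} {A B : Set (Fin n → ℝ)} (hB : B.Finite)
    (h : ∀ w : Fin n → ℝ, Function.Injective w → ∀ a ∈ A, ∃ b ∈ B, w ⬝ᵥ a ≤ w ⬝ᵥ b) :
    convexHull ℝ A ⊆ convexHull ℝ B := by
  refine convexHull_min (fun a ha => ?_) (convex_convexHull ℝ B)
  by_contra hab
  obtain ⟨f, u, hfu, hu⟩ := geometric_hahn_banach_closed_point (convex_convexHull ℝ B)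
    (hB.isClosed_convexHull ℝ) hab
  let w : Fin n → ℝ := fun i => f (Pi.single i 1)
  have hf : ∀ x : Fin n → ℝ, f x = w ⬝ᵥ x := by
    intro x
    conv_lhs => rw [pi_eq_sum_univ' x]
    simp only [map_sum, map_smul, smul_eq_mul, dotProduct, w]
    exact Finset.sum_congr rfl fun i _ => mul_comm _ _
  -- Strict separation from finitely many points survives a small perturbation of `w`.
  have hlt : ∀ b ∈ B, ∀ᶠ ε : ℝ in nhdsWithin 0 (Set.Ioi 0),
      (fun i : Fin n => w i + ε * (i : ℕ)) ⬝ᵥ b < (fun i : Fin n => w i + ε * (i : ℕ)) ⬝ᵥ a := by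
    intro b hb
    have hcont : ∀ x : Fin n → ℝ,
        Continuous fun ε : ℝ => (fun i : Fin n => w i + ε * (i : ℕ)) ⬝ᵥ x := by
      intro x
      simp only [dotProduct]
      fun_prop
    refine Filter.Eventually.filter_mono nhdsWithin_le_nhds ?_
    refine (hcont b).continuousAt.eventually_lt (hcont a).continuousAt ?_
    have := (hfu b (subset_convexHull ℝ B hb)).trans hu
    rw [hf, hf] at this
    simpa using this
  obtain ⟨ε, hinj, hε⟩ := ((eventually_injective_add_smul w).and
    ((Filter.eventually_all_finite hB).2 hlt)).exists
  obtain ⟨b, hb, hab⟩ := h _ hinj a ha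
  exact absurd hab (not_le.2 (hε b hb))

/-! ### Weights of exponents under divided differences -/

/-- The weight of an exponent vector. -/
noncomputable def expWeight {n : ℕ} (w : Fin n → ℝ) (m : Fin n →₀ ℕ) : ℝ := ∑ i, w i * (m i : ℝ)

theorem expWeight_add {n : ℕ} (w : Fin n → ℝ) (m m' : Fin n →₀ ℕ) :
    expWeight w (m + m') = expWeight w m + expWeight w m' := by
  simp [expWeight, mul_add, Finset.sum_add_distrib]

theorem expWeight_single {n : ℕ} (w : Fin n → ℝ) (i : Fin n) :
    expWeight w (Finsupp.single i 1) = w i := by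
  rw [expWeight, Finset.sum_eq_single i]
  · simp
  · intro j _ hj
    simp [hj.symm]
  · simp

theorem expWeight_mapDomain {n : ℕ} (w : Fin n → ℝ) (e : Equiv.Perm (Fin n)) (m : Fin n →₀ ℕ) :
    expWeight w (m.mapDomain e) = expWeight (w ∘ e) m := by
  rw [expWeight, ← Equiv.sum_comp e]
  refine Finset.sum_congr rfl fun i _ => ?_
  rw [Finsupp.mapDomain_apply e.injective]
  rfl

theorem exists_of_mem_support_X_mul {n : ℕ} {i : Fin n} {p : MvPolynomial (Fin n) ℤ}
    {m : Fin n →₀ ℕ} (hm : m ∈ (MvPolynomial.X i * p).support) :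
    ∃ m' ∈ p.support, Finsupp.single i 1 + m' = m := by
  rw [MvPolynomial.support_X_mul, Finset.mem_map] at hm
  exact hm

theorem exists_of_mem_support_rename {n : ℕ} {e : Equiv.Perm (Fin n)}
    {p : MvPolynomial (Fin n) ℤ} {m : Fin n →₀ ℕ}
    (hm : m ∈ (MvPolynomial.rename e p).support) :
    ∃ m' ∈ p.support, m'.mapDomain e = m := by
  classical
  rw [MvPolynomial.support_rename_of_injective e.injective, Finset.mem_image] at hm
  exact hm

theorem mapDomain_mem_support_rename {n : ℕ} (e : Equiv.Perm (Fin n))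
    {p : MvPolynomial (Fin n) ℤ} {m : Fin n →₀ ℕ} (hm : m ∈ p.support) :
    m.mapDomain e ∈ (MvPolynomial.rename e p).support := by
  classical
  rw [MvPolynomial.support_rename_of_injective e.injective]
  exact Finset.mem_image_of_mem _ hm

/-- The operator `f ↦ ∂ (x_i f)`. -/
noncomputable def isobaric {n : ℕ} (i j : Fin n) (f : MvPolynomial (Fin n) ℤ) :
    MvPolynomial (Fin n) ℤ :=
  dividedDifference i j (MvPolynomial.X i * f)

theorem sub_mul_isobaric {n : ℕ} (i j : Fin n) (f : MvPolynomial (Fin n) ℤ) :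
    MvPolynomial.X i * isobaric i j f - MvPolynomial.X j * isobaric i j f =
      MvPolynomial.X i * f - MvPolynomial.X j * MvPolynomial.rename (Equiv.swap i j) f := by
  rw [← sub_mul, isobaric, mul_dividedDifference, map_mul, MvPolynomial.rename_X,
    Equiv.swap_apply_left]

/-- The exchange negates both the numerator and the denominator of the divided difference. -/
theorem rename_isobaric {n : ℕ} {i j : Fin n} (hij : i ≠ j) (f : MvPolynomial (Fin n) ℤ) :
    MvPolynomial.rename (Equiv.swap i j) (isobaric i j f) = isobaric i j f := by
  have hne : (MvPolynomial.X i - MvPolynomial.X j : MvPolynomial (Fin n) ℤ) ≠ 0 := by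
    rw [sub_ne_zero]
    exact fun h => hij (MvPolynomial.X_injective h)
  have h1 := sub_mul_isobaric i j f
  have h2 := congrArg (MvPolynomial.rename (Equiv.swap i j)) h1
  have h3 : MvPolynomial.rename (Equiv.swap i j) (MvPolynomial.rename (Equiv.swap i j) f) = f := by
    rw [MvPolynomial.rename_rename]
    convert MvPolynomial.rename_id_apply f
    ext; simp
  simp only [map_sub, map_mul, MvPolynomial.rename_X, Equiv.swap_apply_left,
    Equiv.swap_apply_right, h3] at h2
  apply mul_left_cancel₀ hne
  linear_combination -h1 - h2

/-- An upper bound for the weights of `f` and of its image under the exchange of variables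
bounds the weights of `∂ (x_i f)`. -/
theorem expWeight_isobaric_le {n : ℕ} {i j : Fin n} {w : Fin n → ℝ} (hw : w j < w i)
    {f : MvPolynomial (Fin n) ℤ} {c : ℝ} (h₁ : ∀ m ∈ f.support, expWeight w m ≤ c)
    (h₂ : ∀ m ∈ f.support, expWeight (w ∘ Equiv.swap i j) m ≤ c) :
    ∀ m ∈ (isobaric i j f).support, expWeight w m ≤ c := by
  intro m hm
  obtain ⟨m₀, hm₀, hmax⟩ := Finset.exists_max_image _ (expWeight w) ⟨m, hm⟩
  refine (hmax m hm).trans ?_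
  -- A heaviest exponent `m₀`, shifted by `x_i`, outweighs everything in the product with `x_j`, so
  -- it survives to the right-hand side of `sub_mul_isobaric`.
  have hnot : Finsupp.single i 1 + m₀ ∉ (MvPolynomial.X j * isobaric i j f).support := by
    intro h
    obtain ⟨m', hm', he⟩ := exists_of_mem_support_X_mul h
    have := congrArg (expWeight w) he
    rw [expWeight_add, expWeight_add, expWeight_single, expWeight_single] at this
    linarith [hmax m' hm']
  have hmem : Finsupp.single i 1 + m₀ ∈ (MvPolynomial.X i * f -
      MvPolynomial.X j * MvPolynomial.rename (Equiv.swap i j) f).support := by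
    rw [← sub_mul_isobaric, MvPolynomial.mem_support_iff, MvPolynomial.coeff_sub,
      MvPolynomial.notMem_support_iff.1 hnot, sub_zero, MvPolynomial.coeff_X_mul]
    exact MvPolynomial.mem_support_iff.1 hm₀
  classical
  rcases Finset.mem_union.1 (MvPolynomial.support_sub _ _ _ hmem) with h | h
  · obtain ⟨m', hm', he⟩ := exists_of_mem_support_X_mul h
    rw [← add_left_cancel he]
    exact h₁ m' hm'
  · obtain ⟨m', hm', he⟩ := exists_of_mem_support_X_mul h
    obtain ⟨m'', hm'', rfl⟩ := exists_of_mem_support_rename hm'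
    have := congrArg (expWeight w) he
    rw [expWeight_add, expWeight_add, expWeight_single, expWeight_single,
      expWeight_mapDomain] at this
    linarith [h₂ m'' hm'']

/-- By the bound on exchanged weights, `x_i` times the monomial of `m` is not cancelled by `x_j s
f`. It therefore occurs in `x_i` or `x_j` times `isobaric i j f`; in the second case the remaining
exponent is even heavier than `m`, as `w j < w i`. -/
theorem exists_expWeight_le_isobaric {n : ℕ} {i j : Fin n} {w : Fin n → ℝ} (hw : w j < w i)
    {f : MvPolynomial (Fin n) ℤ} {m : Fin n →₀ ℕ} (hm : m ∈ f.support)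
    (h : ∀ m' ∈ f.support, expWeight (w ∘ Equiv.swap i j) m' ≤ expWeight w m) :
    ∃ m' ∈ (isobaric i j f).support, expWeight w m ≤ expWeight w m' := by
  have hnot : Finsupp.single i 1 + m ∉
      (MvPolynomial.X j * MvPolynomial.rename (Equiv.swap i j) f).support := by
    intro h'
    obtain ⟨m', hm', he⟩ := exists_of_mem_support_X_mul h'
    obtain ⟨m'', hm'', rfl⟩ := exists_of_mem_support_rename hm'
    have := congrArg (expWeight w) he
    rw [expWeight_add, expWeight_add, expWeight_single, expWeight_single,
      expWeight_mapDomain] at this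
    linarith [h m'' hm'']
  have hmem : Finsupp.single i 1 + m ∈ (MvPolynomial.X i * isobaric i j f -
      MvPolynomial.X j * isobaric i j f).support := by
    rw [sub_mul_isobaric, MvPolynomial.mem_support_iff, MvPolynomial.coeff_sub,
      MvPolynomial.notMem_support_iff.1 hnot, sub_zero, MvPolynomial.coeff_X_mul]
    exact MvPolynomial.mem_support_iff.1 hm
  classical
  rcases Finset.mem_union.1 (MvPolynomial.support_sub _ _ _ hmem) with h | h
  · obtain ⟨m', hm', he⟩ := exists_of_mem_support_X_mul h
    exact ⟨m', hm', (congrArg (expWeight w) (add_left_cancel he)).ge⟩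
  · obtain ⟨m', hm', he⟩ := exists_of_mem_support_X_mul h
    have := congrArg (expWeight w) he
    rw [expWeight_add, expWeight_add, expWeight_single, expWeight_single] at this
    exact ⟨m', hm', by linarith⟩

/-! ### Weights of column sums -/

theorem dotProduct_intVec_sum_indVec {n : ℕ} (w : Fin n → ℝ) (s : Finset ℕ)
    (T : ℕ → Finset (Fin n)) :
    w ⬝ᵥ intVec (∑ j ∈ s, indVec (T j)) = ∑ j ∈ s, ∑ x ∈ T j, w x := by
  simp only [dotProduct, intVec_apply, Finset.sum_apply, Int.cast_sum, Finset.mul_sum]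
  rw [Finset.sum_comm]
  refine Finset.sum_congr rfl fun j _ => ?_
  simp [indVec]

/-- Weights add up over columns, so the comparison can be made column by column. -/
theorem exists_dotProduct_le_columnSums {n N : ℕ} {α β : Fin n → ℕ} {u w : Fin n → ℝ}
    (h : ∀ j, ∀ T, GaleLE T (skylineColumn α j) →
      ∃ T', GaleLE T' (skylineColumn β j) ∧ ∑ x ∈ T, u x ≤ ∑ x ∈ T', w x) :
    ∀ a ∈ columnSums N α, ∃ b ∈ columnSums N β, u ⬝ᵥ intVec a ≤ w ⬝ᵥ intVec b := by
  intro a ha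
  obtain ⟨T, hT, rfl⟩ := mem_columnSums.1 ha
  have : ∀ j, ∃ T', j ∈ Finset.Icc 1 N → GaleLE T' (skylineColumn β j) ∧
      ∑ x ∈ T j, u x ≤ ∑ x ∈ T', w x := by
    intro j
    by_cases hj : j ∈ Finset.Icc 1 N
    · obtain ⟨T', hT'⟩ := h j _ (hT j hj)
      exact ⟨T', fun _ => hT'⟩
    · exact ⟨∅, fun h => absurd h hj⟩
  choose T' hT' using this
  refine ⟨_, mem_columnSums.2 ⟨T', fun j hj => (hT' j hj).1, rfl⟩, ?_⟩
  rw [dotProduct_intVec_sum_indVec, dotProduct_intVec_sum_indVec]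
  exact Finset.sum_le_sum fun j hj => (hT' j hj).2

theorem sum_swapSet {n : ℕ} (i j : Fin n) (w : Fin n → ℝ) (T : Finset (Fin n)) :
    ∑ x ∈ swapSet i j T, w x = ∑ x ∈ T, (w ∘ Equiv.swap i j) x := by
  rw [swapSet, Finset.sum_map]
  rfl

theorem sum_comp_swap_le {n : ℕ} {i j : Fin n} {w : Fin n → ℝ} (hw : w j ≤ w i)
    {T : Finset (Fin n)} (hT : j ∈ T → i ∈ T) :
    ∑ x ∈ T, (w ∘ Equiv.swap i j) x ≤ ∑ x ∈ T, w x := by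
  by_cases hj : j ∈ T
  · rw [← sum_swapSet, swapSet_eq_self (iff_of_true (hT hj) hj)]
  · refine Finset.sum_le_sum fun x hx => ?_
    have h2 : x ≠ j := by rintro rfl; exact hj hx
    by_cases h1 : x = i
    · subst h1; simpa using hw
    · simp [Equiv.swap_apply_of_ne_of_ne h1 h2]

/-! ### Column sums under an adjacent exchange -/

section

variable {n N : ℕ} {α : Fin n → ℕ} {i j : Fin n} {w : Fin n → ℝ}

theorem exists_le_columnSums_of_comp_swap (hij : (i : ℕ) + 1 = j) (hα : α i < α j) :
    ∀ a ∈ columnSums N (α ∘ Equiv.swap i j), ∃ b ∈ columnSums N α,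
      w ⬝ᵥ intVec a ≤ w ⬝ᵥ intVec b := by
  refine exists_dotProduct_le_columnSums fun k T hT => ⟨T, ?_, le_rfl⟩
  rw [skylineColumn_comp_swap] at hT
  by_cases hi : i ∈ skylineColumn α k
  · rwa [swapSet_eq_self] at hT
    rw [mem_skylineColumn] at hi
    simp only [mem_skylineColumn]
    omega
  · exact hT.trans (galeLE_swapSet_of_mem hij hi (galeLE_refl _))

theorem exists_comp_swap_le_columnSums (hij : (i : ℕ) + 1 = j) (hw : w j < w i) :
    ∀ a ∈ columnSums N α, ∃ b ∈ columnSums N α,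
      (w ∘ Equiv.swap i j) ⬝ᵥ intVec a ≤ w ⬝ᵥ intVec b := by
  refine exists_dotProduct_le_columnSums fun k T hT => ?_
  by_cases h : j ∈ T → i ∈ T
  · exact ⟨T, hT, sum_comp_swap_le hw.le h⟩
  · push Not at h
    exact ⟨_, galeLE_swapSet_of_mem hij h.2 hT, (sum_swapSet i j w T).ge⟩

/-- A column `D` containing `i` also contains `j` and is fixed. Otherwise, a basis `T` of `D`
containing `j` only with `i` already satisfies `T ≼ s D`; if it contains `j` alone, `s T ≼ s D` is
heavier. -/
theorem exists_le_columnSums_comp_swap (hij : (i : ℕ) + 1 = j) (hα : α i < α j) (hw : w j < w i) :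
    ∀ a ∈ columnSums N α, ∃ b ∈ columnSums N (α ∘ Equiv.swap i j),
      w ⬝ᵥ intVec a ≤ w ⬝ᵥ intVec b := by
  refine exists_dotProduct_le_columnSums fun k T hT => ?_
  rw [skylineColumn_comp_swap]
  by_cases hi : i ∈ skylineColumn α k
  · refine ⟨T, ?_, le_rfl⟩
    rwa [swapSet_eq_self]
    rw [mem_skylineColumn] at hi
    simp only [mem_skylineColumn]
    omega
  · by_cases h : j ∈ T → i ∈ T
    · exact ⟨T, galeLE_swapSet_right hij hi h hT, le_rfl⟩
    · push Not at h
      refine ⟨_, swapSet_galeLE_swapSet hij h.2 hT, ?_⟩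
      have := sum_comp_swap_le hw.le (T := swapSet i j T) (by simp [h.2])
      rwa [← sum_swapSet, swapSet_swapSet] at this

theorem exists_comp_swap_le_columnSums_of_lt (hij : (i : ℕ) + 1 = j) (hα : α i < α j) :
    ∀ a ∈ columnSums N α, ∃ b ∈ columnSums N α,
      (w ∘ Equiv.swap i j) ⬝ᵥ intVec a ≤ w ⬝ᵥ intVec b := by
  refine exists_dotProduct_le_columnSums fun k T hT =>
    ⟨_, galeLE_swapSet_of_imp hij ?_ hT, (sum_swapSet i j w T).ge⟩
  simp only [mem_skylineColumn]
  omega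

end

/-! ### Key polynomials against column sums -/

theorem galeLE_skylineColumn_of_antitone {n : ℕ} {α : Fin n → ℕ} (hα : Antitone α) {j : ℕ}
    {T : Finset (Fin n)} (h : GaleLE T (skylineColumn α j)) : T = skylineColumn α j := by
  symm
  refine Finset.eq_of_subset_of_card_le (fun i hi => ?_) h.1.le
  -- The columns of a weakly decreasing composition are initial segments, which have no other basis.
  refine h.mem_of_forall_le fun a ha => ?_
  rw [mem_skylineColumn] at hi ⊢
  exact hi.trans (hα ha)

theorem coe_mem_columnSums {n N : ℕ} {α : Fin n → ℕ} (hN : ∀ i, α i ≤ N) :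
    (fun i => (α i : ℤ)) ∈ columnSums N α :=
  mem_columnSums.2 ⟨_, fun _ _ => galeLE_refl _, (sum_indVec_skylineColumn hN).symm⟩

theorem columnSums_of_antitone {n N : ℕ} {α : Fin n → ℕ} (hN : ∀ i, α i ≤ N) (hα : Antitone α) :
    columnSums N α = {fun i => (α i : ℤ)} := by
  refine Set.Subset.antisymm (fun x hx => ?_) (Set.singleton_subset_iff.2 (coe_mem_columnSums hN))
  obtain ⟨T, hT, rfl⟩ := mem_columnSums.1 hx
  rw [Set.mem_singleton_iff, ← sum_indVec_skylineColumn hN]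
  exact Finset.sum_congr rfl fun j hj =>
    congrArg indVec (galeLE_skylineColumn_of_antitone hα (hT j hj))

theorem prod_X_pow_eq_monomial_equivFunOnFinite {n : ℕ} (α : Fin n → ℕ) :
    (∏ i, MvPolynomial.X i ^ α i : MvPolynomial (Fin n) ℤ) =
      MvPolynomial.monomial (Finsupp.equivFunOnFinite.symm α) 1 := by
  rw [MvPolynomial.monomial_eq, map_one, one_mul, Finsupp.prod_fintype _ _ (by simp)]
  rfl

/-- Exponents of a key polynomial and column sums have the same maxima with respect to weights
with pairwise distinct entries. -/
theorem IsKeyPolynomial.compare {n N : ℕ} {α : Fin n → ℕ} {κ : MvPolynomial (Fin n) ℤ}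
    (hκ : IsKeyPolynomial α κ) (hN : ∀ i, α i ≤ N) :
    ∀ w : Fin n → ℝ, Function.Injective w →
      (∀ m ∈ κ.support, ∃ a ∈ columnSums N α, expWeight w m ≤ w ⬝ᵥ intVec a) ∧
      (∀ a ∈ columnSums N α, ∃ m ∈ κ.support, w ⬝ᵥ intVec a ≤ expWeight w m) := by
  induction hκ with
  | of_antitone α hα =>
    intro w _
    have e : expWeight w (Finsupp.equivFunOnFinite.symm α) =
        w ⬝ᵥ intVec (fun i => (α i : ℤ)) := by
      simp [expWeight, dotProduct]
    rw [columnSums_of_antitone hN hα, prod_X_pow_eq_monomial_equivFunOnFinite,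
      MvPolynomial.support_monomial, if_neg one_ne_zero]
    simp [e]
  | of_lt α i j hij hlt f hf ih =>
    replace ih := ih fun k => hN _
    have hne : i ≠ j := by rintro rfl; omega
    change ∀ w : Fin n → ℝ, Function.Injective w →
      (∀ m ∈ (isobaric i j f).support, ∃ a ∈ columnSums N α, expWeight w m ≤ w ⬝ᵥ intVec a) ∧
      (∀ a ∈ columnSums N α, ∃ m ∈ (isobaric i j f).support, w ⬝ᵥ intVec a ≤ expWeight w m)
    have main : ∀ w : Fin n → ℝ, Function.Injective w → w j < w i →
      (∀ m ∈ (isobaric i j f).support, ∃ a ∈ columnSums N α, expWeight w m ≤ w ⬝ᵥ intVec a) ∧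
      (∀ a ∈ columnSums N α, ∃ m ∈ (isobaric i j f).support,
        w ⬝ᵥ intVec a ≤ expWeight w m) := by
      intro w hw hwij
      -- The weight of `M` is the common maximum through which both inequalities pass.
      obtain ⟨M, hM, hmax⟩ := Set.exists_max_image (columnSums N (α ∘ Equiv.swap i j))
        (fun a => w ⬝ᵥ intVec a) (finite_columnSums _ _)
        ⟨_, coe_mem_columnSums fun k => hN _⟩
      have h₂ : ∀ m ∈ f.support, expWeight (w ∘ Equiv.swap i j) m ≤ w ⬝ᵥ intVec M := by
        intro m hm
        obtain ⟨a, ha, hle⟩ := (ih _ (hw.comp (Equiv.injective _))).1 m hm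
        obtain ⟨b, hb, hle'⟩ := exists_comp_swap_le_columnSums hij hwij a ha
        exact (hle.trans hle').trans (hmax b hb)
      constructor
      · intro m hm
        obtain ⟨b, hb, hle⟩ := exists_le_columnSums_of_comp_swap hij hlt M hM (w := w)
        refine ⟨b, hb, le_trans ?_ hle⟩
        refine expWeight_isobaric_le hwij (fun m hm => ?_) h₂ m hm
        obtain ⟨a, ha, hle⟩ := (ih w hw).1 m hm
        exact hle.trans (hmax a ha)
      · intro a ha
        obtain ⟨b, hb, hle⟩ := exists_le_columnSums_comp_swap hij hlt hwij a ha
        obtain ⟨m, hm, hle'⟩ := (ih w hw).2 M hM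
        obtain ⟨m', hm', hle''⟩ := exists_expWeight_le_isobaric hwij hm
          fun m' hm' => (h₂ m' hm').trans hle'
        exact ⟨m', hm', (hle.trans (hmax b hb)).trans (hle'.trans hle'')⟩
    intro w hw
    rcases lt_or_gt_of_ne (fun h => hne (hw h) : w i ≠ w j) with hwij | hwij
    -- For `w i < w j` the exchanged weight falls under `main`; exponents and column sums are
    -- carried back by the symmetry of both sides.
    · have hs : ∀ m ∈ (isobaric i j f).support,
          m.mapDomain (Equiv.swap i j) ∈ (isobaric i j f).support := by
        intro m hm
        have := mapDomain_mem_support_rename (Equiv.swap i j) hm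
        rwa [rename_isobaric hne] at this
      have hww : (w ∘ Equiv.swap i j) ∘ Equiv.swap i j = w := by
        ext; simp
      obtain ⟨h1, h2⟩ := main _ (hw.comp (Equiv.injective (Equiv.swap i j))) (by simpa using hwij)
      constructor
      · intro m hm
        obtain ⟨a, ha, hle⟩ := h1 _ (hs m hm)
        rw [expWeight_mapDomain, hww] at hle
        obtain ⟨b, hb, hle'⟩ := exists_comp_swap_le_columnSums_of_lt hij hlt a ha (w := w)
        exact ⟨b, hb, hle.trans hle'⟩
      · intro a ha
        obtain ⟨b, hb, hle⟩ := exists_comp_swap_le_columnSums_of_lt hij hlt a ha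
          (w := w ∘ Equiv.swap i j)
        rw [hww] at hle
        obtain ⟨m, hm, hle'⟩ := h2 b hb
        refine ⟨_, hs m hm, ?_⟩
        rw [expWeight_mapDomain]
        exact hle.trans hle'
    · exact main w hw hwij

/-- The Newton polytope of a key polynomial is the Minkowski sum of the base polytopes of the
Schubert matroids of the columns of the skyline diagram. -/
theorem IsKeyPolynomial.newtonPolytope_eq {n N : ℕ} {α : Fin n → ℕ} {κ : MvPolynomial (Fin n) ℤ}
    (hκ : IsKeyPolynomial α κ) (hN : ∀ i, α i ≤ N) :
    newtonPolytope κ = convexHull ℝ (intVec '' columnSums N α) := by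
  have e : ∀ (w : Fin n → ℝ) (m : Fin n →₀ ℕ),
      w ⬝ᵥ (fun i => ((m i : ℕ) : ℝ)) = expWeight w m := fun _ _ => rfl
  apply Set.Subset.antisymm
  · refine convexHull_subset_of_forall_injective ((finite_columnSums N α).image _) ?_
    rintro w hw _ ⟨m, hm, rfl⟩
    obtain ⟨a, ha, hle⟩ := (hκ.compare hN w hw).1 m hm
    exact ⟨_, ⟨a, ha, rfl⟩, hle⟩
  · refine convexHull_subset_of_forall_injective (κ.support.finite_toSet.image _) ?_
    rintro w hw _ ⟨a, ha, rfl⟩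
    obtain ⟨m, hm, hle⟩ := (hκ.compare hN w hw).2 a ha
    exact ⟨_, ⟨m, hm, rfl⟩, hle⟩

theorem extremePoints_newtonPolytope_subset {n : ℕ} {κ : MvPolynomial (Fin n) ℤ} :
    (newtonPolytope κ).extremePoints ℝ ⊆ newtonPolytope κ ∩ integerLattice n := by
  intro x hx
  refine ⟨hx.1, ?_⟩
  obtain ⟨m, _, rfl⟩ := extremePoints_convexHull_subset hx
  exact fun i => ⟨m i, by simp⟩

/-! ### Sums of sets which vary in disjoint sets of coordinates -/

/-- The coordinate `i` takes a single, integer value on `P`. -/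
def ConstantAt {n : ℕ} (P : Set (Fin n → ℝ)) (i : Fin n) : Prop :=
  ∃ c : ℤ, ∀ x ∈ P, x i = c

/-- The coordinate `i` takes values in an interval `[c, c + 1]` with `c` an integer on `P`. -/
def UnitAt {n : ℕ} (P : Set (Fin n → ℝ)) (i : Fin n) : Prop :=
  ∃ c : ℤ, ∀ x ∈ P, (c : ℝ) ≤ x i ∧ x i ≤ c + 1

section

variable {n : ℕ} {κ : Type*} {P Q : Set (Fin n → ℝ)} {i : Fin n}

theorem ConstantAt.unitAt (hP : ConstantAt P i) : UnitAt P i := by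
  obtain ⟨c, hc⟩ := hP
  exact ⟨c, fun x hx => by rw [hc x hx]; constructor <;> linarith⟩

theorem ConstantAt.add (hP : ConstantAt P i) (hQ : ConstantAt Q i) : ConstantAt (P + Q) i := by
  obtain ⟨c, hc⟩ := hP
  obtain ⟨d, hd⟩ := hQ
  refine ⟨c + d, ?_⟩
  rintro _ ⟨x, hx, y, hy, rfl⟩
  simp [hc x hx, hd y hy]

theorem constantAt_zero : ConstantAt (0 : Set (Fin n → ℝ)) i :=
  ⟨0, by rintro x rfl; simp⟩

theorem ConstantAt.sum {s : Finset κ} {P : κ → Set (Fin n → ℝ)}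
    (h : ∀ k ∈ s, ConstantAt (P k) i) : ConstantAt (∑ k ∈ s, P k) i :=
  Finset.sum_induction P (ConstantAt · i) (fun _ _ => ConstantAt.add) constantAt_zero h

theorem ConstantAt.natCast_smul (hP : ConstantAt P i) (t : ℕ) : ConstantAt ((t : ℝ) • P) i := by
  obtain ⟨c, hc⟩ := hP
  refine ⟨t * c, ?_⟩
  rintro _ ⟨x, hx, rfl⟩
  simp [hc x hx]

theorem UnitAt.add_constantAt (hP : UnitAt P i) (hQ : ConstantAt Q i) : UnitAt (P + Q) i := by
  obtain ⟨c, hc⟩ := hP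
  obtain ⟨d, hd⟩ := hQ
  refine ⟨c + d, ?_⟩
  rintro _ ⟨x, hx, y, hy, rfl⟩
  have := hc x hx
  simp only [Pi.add_apply, hd y hy, Int.cast_add]
  constructor <;> linarith

/-- For any two of the sets, one is constant at each coordinate. -/
def VaryDisjointly (s : Finset κ) (P : κ → Set (Fin n → ℝ)) : Prop :=
  ∀ i, ∀ j ∈ s, ∀ k ∈ s, j ≠ k → ConstantAt (P j) i ∨ ConstantAt (P k) i

theorem VaryDisjointly.mono {s t : Finset κ} {P : κ → Set (Fin n → ℝ)} (h : VaryDisjointly t P)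
    (hst : s ⊆ t) : VaryDisjointly s P :=
  fun i j hj k hk => h i j (hst hj) k (hst hk)

theorem VaryDisjointly.constantAt_or [DecidableEq κ] {s : Finset κ} {P : κ → Set (Fin n → ℝ)}
    {a : κ} (ha : a ∉ s) (h : VaryDisjointly (insert a s) P) (i : Fin n) :
    ConstantAt (P a) i ∨ ConstantAt (∑ k ∈ s, P k) i := by
  by_cases hc : ConstantAt (P a) i
  · exact Or.inl hc
  · refine Or.inr (.sum fun k hk => ?_)
    exact (h i a (Finset.mem_insert_self a s) k (Finset.mem_insert_of_mem hk)
      (by rintro rfl; exact ha hk)).resolve_left hc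

theorem VaryDisjointly.unitAt_sum {s : Finset κ} {P : κ → Set (Fin n → ℝ)}
    (h : VaryDisjointly s P) (hP : ∀ k ∈ s, UnitAt (P k) i) : UnitAt (∑ k ∈ s, P k) i := by
  classical
  induction s using Finset.induction_on with
  | empty => simpa using constantAt_zero.unitAt
  | insert a s ha ih =>
    rw [Finset.sum_insert ha]
    rcases h.constantAt_or ha i with hc | hc
    · rw [add_comm]
      exact (ih (h.mono (Finset.subset_insert a s))
        fun k hk => hP k (Finset.mem_insert_of_mem hk)).add_constantAt hc
    · exact (hP a (Finset.mem_insert_self a s)).add_constantAt hc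

/-- Where one summand is constant, its value is a known integer. The sum therefore determines the
other summand, and integrality passes to it; so addition is a bijection on lattice points. -/
theorem ncard_add_inter_integerLattice (h : ∀ i, ConstantAt P i ∨ ConstantAt Q i) :
    ((P + Q) ∩ integerLattice n).ncard =
      (P ∩ integerLattice n).ncard * (Q ∩ integerLattice n).ncard := by
  have e : (P + Q) ∩ integerLattice n =
      (fun p : (Fin n → ℝ) × (Fin n → ℝ) => p.1 + p.2) ''
        ((P ∩ integerLattice n) ×ˢ (Q ∩ integerLattice n)) := by
    ext z
    constructor
    · rintro ⟨⟨x, hx, y, hy, rfl⟩, hz⟩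
      refine ⟨(x, y), ⟨⟨hx, fun i => ?_⟩, ⟨hy, fun i => ?_⟩⟩, rfl⟩
      all_goals
        obtain ⟨c, hc⟩ := hz i
        simp only [Pi.add_apply] at hc
        rcases h i with ⟨d, hd⟩ | ⟨d, hd⟩
      · exact ⟨d, hd x hx⟩
      · exact ⟨c - d, by rw [Int.cast_sub, ← hc, ← hd y hy]; ring⟩
      · exact ⟨c - d, by rw [Int.cast_sub, ← hc, ← hd x hx]; ring⟩
      · exact ⟨d, hd y hy⟩
    · rintro ⟨⟨x, y⟩, ⟨⟨hx, hxZ⟩, ⟨hy, hyZ⟩⟩, rfl⟩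
      refine ⟨Set.add_mem_add hx hy, fun i => ?_⟩
      obtain ⟨c, hc⟩ := hxZ i
      obtain ⟨d, hd⟩ := hyZ i
      exact ⟨c + d, by simp only [Pi.add_apply] at *; rw [hc, hd, Int.cast_add]⟩
  rw [e, Set.InjOn.ncard_image, Set.ncard_prod]
  rintro ⟨x, y⟩ ⟨⟨hx, _⟩, ⟨hy, _⟩⟩ ⟨x', y'⟩ ⟨⟨hx', _⟩, ⟨hy', _⟩⟩ heq
  simp only at hx hy hx' hy'
  have key : ∀ i, x i = x' i ∧ y i = y' i := by
    intro i
    have h1 : x i + y i = x' i + y' i := congrFun heq i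
    rcases h i with ⟨d, hd⟩ | ⟨d, hd⟩
    · have h2 := (hd x hx).trans (hd x' hx').symm
      exact ⟨h2, by linarith⟩
    · have h2 := (hd y hy).trans (hd y' hy').symm
      exact ⟨by linarith, h2⟩
  exact Prod.ext (funext fun i => (key i).1) (funext fun i => (key i).2)

theorem VaryDisjointly.ncard_sum_inter_integerLattice {s : Finset κ}
    {P : κ → Set (Fin n → ℝ)} (h : VaryDisjointly s P) :
    ((∑ k ∈ s, P k) ∩ integerLattice n).ncard =
      ∏ k ∈ s, (P k ∩ integerLattice n).ncard := by
  classical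
  induction s using Finset.induction_on with
  | empty =>
    have : (0 : Set (Fin n → ℝ)) ∩ integerLattice n = {0} := by
      ext x
      simp only [Set.mem_inter_iff, Set.mem_zero, Set.mem_singleton_iff, and_iff_left_iff_imp]
      rintro rfl
      exact fun i => ⟨0, by simp⟩
    rw [Finset.sum_empty, Finset.prod_empty, this, Set.ncard_singleton]
  | insert a s ha ih =>
    rw [Finset.sum_insert ha, Finset.prod_insert ha,
      ncard_add_inter_integerLattice (h.constantAt_or ha),
      ih (h.mono (Finset.subset_insert a s))]

/-- Each coordinate of a lattice point is an endpoint of its unit interval, so the point is interior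
to no segment in `P`. -/
theorem mem_extremePoints_of_unitAt (hP : ∀ i, UnitAt P i) {x : Fin n → ℝ} (hx : x ∈ P)
    (hxZ : x ∈ integerLattice n) : x ∈ P.extremePoints ℝ := by
  refine ⟨hx, ?_⟩
  rintro y hy z hz ⟨a, b, ha, hb, hab, rfl⟩
  ext i
  obtain ⟨c, hc⟩ := hP i
  obtain ⟨d, hd⟩ := hxZ i
  have hy' := hc y hy
  have hz' := hc z hz
  have hx' := hc _ hx
  rw [hd] at hx'
  have hdc : d = c ∨ d = c + 1 := by
    have h1 : c ≤ d := by exact_mod_cast hx'.1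
    have h2 : d ≤ c + 1 := by exact_mod_cast hx'.2
    omega
  rw [hd]
  simp only [Pi.add_apply, Pi.smul_apply, smul_eq_mul] at hd
  obtain rfl : b = 1 - a := by linarith
  rcases hdc with rfl | rfl
  · nlinarith
  · push_cast at *
    nlinarith

end

/-! ### Compositions avoiding the pattern -/

/-- In the first case `i` is a coloop of the Schubert matroid, in the second a loop. -/
theorem constantAt_galeVectors {n : ℕ} {D : Finset (Fin n)} {i : Fin n}
    (h : (∀ a ≤ i, a ∈ D) ∨ ∀ b, i ≤ b → b ∉ D) :
    ConstantAt (convexHull ℝ (intVec '' galeVectors D)) i := by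
  refine ⟨indVec D i, fun x hx => ?_⟩
  have hsub : convexHull ℝ (intVec '' galeVectors D) ⊆ {x | x i = indVec D i} := by
    refine convexHull_min ?_ (convex_hyperplane ⟨fun _ _ => rfl, fun _ _ => rfl⟩ _)
    rintro _ ⟨_, ⟨T, hT, rfl⟩, rfl⟩
    rw [Set.mem_ofPred_eq, intVec_apply, indVec, indVec]
    rcases h with h | h
    · rw [if_pos (GaleLE.mem_of_forall_le hT h), if_pos (h i le_rfl)]
    · rw [if_neg (GaleLE.notMem_of_forall_ge hT h), if_neg (h i le_rfl)]
  exact hsub hx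

theorem unitAt_galeVectors {n : ℕ} (D : Finset (Fin n)) (i : Fin n) :
    UnitAt (convexHull ℝ (intVec '' galeVectors D)) i := by
  refine ⟨0, fun x hx => ?_⟩
  have hsub : convexHull ℝ (intVec '' galeVectors D) ⊆ {x | 0 ≤ x i} ∩ {x | x i ≤ 1} := by
    refine convexHull_min ?_ ((convex_halfSpace_ge ⟨fun _ _ => rfl, fun _ _ => rfl⟩ _).inter
      (convex_halfSpace_le ⟨fun _ _ => rfl, fun _ _ => rfl⟩ _))
    rintro _ ⟨_, ⟨T, hT, rfl⟩, rfl⟩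
    simp only [Set.mem_inter_iff, Set.mem_ofPred_eq, intVec_apply, indVec]
    split_ifs <;> simp
  simpa using hsub hx

/-- If columns `j < k` both vary at `i`, some `a ≤ i` is missing from column `j` and some `b ≥ i`
lies in column `k`. Then `α a < j < k ≤ α b`, which is the forbidden pattern. -/
theorem AvoidsZeroTwo.varyDisjointly {n : ℕ} {α : Fin n → ℕ} (h : AvoidsZeroTwo α)
    (s : Finset ℕ) :
    VaryDisjointly s fun j => convexHull ℝ (intVec '' galeVectors (skylineColumn α j)) := by
  intro i j _ k _ hjk
  wlog hlt : j < k generalizing j k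
  · exact (this k ‹_› j ‹_› hjk.symm (by omega)).symm
  by_contra hno
  push Not at hno
  have h1 := mt constantAt_galeVectors hno.1
  have h2 := mt constantAt_galeVectors hno.2
  simp only [mem_skylineColumn] at h1 h2
  push Not at h1 h2
  obtain ⟨a, ha, hja⟩ := h1.1
  obtain ⟨b, hb, hkb⟩ := h2.2
  have hab : a ≠ b := by rintro rfl; omega
  exact h ⟨a, b, lt_of_le_of_ne (ha.trans hb) hab, by omega⟩

/-! ### Compositions containing the pattern -/

theorem ncard_add_le {G : Type*} [AddGroup G] (B C : Set G) :
    (B + C).ncard ≤ B.ncard * C.ncard := by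
  simpa only [Nat.card_coe_set_eq] using Set.natCard_add_le (s := B) (t := C)

theorem ncard_sum_le {G κ : Type*} [AddCommGroup G] (s : Finset κ) (B : κ → Set G) :
    (∑ k ∈ s, B k).ncard ≤ ∏ k ∈ s, (B k).ncard := by
  classical
  induction s using Finset.induction_on with
  | empty => exact (Set.ncard_singleton (0 : G)).le
  | insert a s ha ih =>
    rw [Finset.sum_insert ha, Finset.prod_insert ha]
    exact (ncard_add_le _ _).trans (Nat.mul_le_mul_left _ ih)

theorem ncard_add_lt {G : Type*} [AddGroup G] {B C : Set G} (hB : B.Finite) (hC : C.Finite)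
    {b b' c c' : G} (hb : b ∈ B) (hb' : b' ∈ B) (hc : c ∈ C) (hc' : c' ∈ C) (hne : b ≠ b')
    (heq : b + c = b' + c') : (B + C).ncard < B.ncard * C.ncard := by
  refine lt_of_le_of_ne (ncard_add_le B C) fun h => ?_
  rw [← Set.add_image_prod, ← Set.ncard_prod, Set.ncard_image_iff (hB.prod hC)] at h
  exact hne (congrArg Prod.fst (h (Set.mk_mem_prod hb hc) (Set.mk_mem_prod hb' hc') heq))

/-- If the pattern occurs, two of the columns admit the same elementary move. -/
theorem exists_common_move {n N : ℕ} {α : Fin n → ℕ} (hN : ∀ i, α i ≤ N)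
    (h : ¬ AvoidsZeroTwo α) : ∃ j₁ ∈ Finset.Icc 1 N, ∃ j₂ ∈ (Finset.Icc 1 N).erase j₁,
      ∃ v : Fin n → ℤ, v ≠ 0 ∧
        indVec (skylineColumn α j₁) + v ∈ galeVectors (skylineColumn α j₁) ∧
        indVec (skylineColumn α j₂) + v ∈ galeVectors (skylineColumn α j₂) := by
  rw [AvoidsZeroTwo, not_not] at h
  obtain ⟨i, k, hik, hα⟩ := h
  have hk := hN k
  have key : ∀ j, α i < j → j ≤ α k → indVec (skylineColumn α j) +
      (Pi.single i 1 - Pi.single k 1) ∈ galeVectors (skylineColumn α j) := by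
    intro j hij hjk
    have hi : i ∉ skylineColumn α j := by simpa using hij
    have hk : k ∈ skylineColumn α j := by simpa using hjk
    refine ⟨_, galeLE_insert_erase hik hi hk, ?_⟩
    rw [indVec_insert_erase hk hi]
    abel
  -- Both columns contain `k` and omit `i`, because `α i + 2 ≤ α k`.
  refine ⟨α i + 1, ?_, α i + 2, ?_, Pi.single i 1 - Pi.single k 1, fun h0 => ?_,
    key _ (by omega) (by omega), key _ (by omega) (by omega)⟩
  · rw [Finset.mem_Icc]; omega
  · rw [Finset.mem_erase, Finset.mem_Icc]; omega
  · have := congrFun h0 i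
    simp [hik.ne] at this

theorem indVec_mem_galeVectors {n : ℕ} (D : Finset (Fin n)) : indVec D ∈ galeVectors D :=
  ⟨D, galeLE_refl D, rfl⟩

theorem nonempty_sum_galeVectors {n : ℕ} (s : Finset ℕ) (D : ℕ → Finset (Fin n)) :
    (∑ j ∈ s, galeVectors (D j)).Nonempty :=
  ⟨_, Set.finsetSum_mem_finsetSum s _ (fun j => indVec (D j))
    fun j _ => indVec_mem_galeVectors (D j)⟩

theorem columnSums_eq_add {n N : ℕ} (α : Fin n → ℕ) {j₁ j₂ : ℕ} (h₁ : j₁ ∈ Finset.Icc 1 N)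
    (h₂ : j₂ ∈ (Finset.Icc 1 N).erase j₁) :
    columnSums N α = galeVectors (skylineColumn α j₁) + galeVectors (skylineColumn α j₂) +
      ∑ j ∈ ((Finset.Icc 1 N).erase j₁).erase j₂, galeVectors (skylineColumn α j) := by
  rw [columnSums, ← Finset.add_sum_erase _ _ h₁, ← Finset.add_sum_erase _ _ h₂, add_assoc]

theorem ncard_columnSums_lt {n N : ℕ} {α : Fin n → ℕ} (hN : ∀ i, α i ≤ N)
    (h : ¬ AvoidsZeroTwo α) :
    (columnSums N α).ncard < ∏ j ∈ Finset.Icc 1 N, (galeVectors (skylineColumn α j)).ncard := by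
  obtain ⟨j₁, h₁, j₂, h₂, v, hv, hv₁, hv₂⟩ := exists_common_move hN h
  rw [columnSums_eq_add α h₁ h₂, ← Finset.mul_prod_erase _ _ h₁, ← Finset.mul_prod_erase _ _ h₂,
    ← mul_assoc]
  refine (ncard_add_le _ _).trans_lt ?_
  refine Nat.mul_lt_mul_of_lt_of_le (ncard_add_lt (finite_galeVectors _) (finite_galeVectors _)
    hv₁ (indVec_mem_galeVectors _) (indVec_mem_galeVectors _) hv₂ (by simpa using hv)
    (by abel)) (ncard_sum_le _ _) ?_
  exact Finset.prod_pos fun j _ =>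
    (Set.ncard_pos (finite_galeVectors _)).2 ⟨_, indVec_mem_galeVectors _⟩

theorem not_isLatticeFree {n N : ℕ} {α : Fin n → ℕ} (hN : ∀ i, α i ≤ N)
    (h : ¬ AvoidsZeroTwo α) : ¬ IsLatticeFree (convexHull ℝ (intVec '' columnSums N α)) := by
  intro hfree
  obtain ⟨j₁, h₁, j₂, h₂, v, hv, hv₁, hv₂⟩ := exists_common_move hN h
  have hA := columnSums_eq_add α h₁ h₂
  obtain ⟨r, hr⟩ := nonempty_sum_galeVectors (((Finset.Icc 1 N).erase j₁).erase j₂)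
    (skylineColumn α)
  set b := indVec (skylineColumn α j₁)
  set c := indVec (skylineColumn α j₂)
  have hb : b ∈ galeVectors (skylineColumn α j₁) := indVec_mem_galeVectors _
  have hc : c ∈ galeVectors (skylineColumn α j₂) := indVec_mem_galeVectors _
  have hmem : ∀ x ∈ columnSums N α, intVec x ∈ convexHull ℝ (intVec '' columnSums N α) :=
    fun x hx => subset_convexHull ℝ _ ⟨x, hx, rfl⟩
  have m1 := hmem (b + c + r) (hA ▸ Set.add_mem_add (Set.add_mem_add hb hc) hr)
  have m2 := hmem (b + v + c + r) (hA ▸ Set.add_mem_add (Set.add_mem_add hv₁ hc) hr)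
  have m3 := hmem (b + v + (c + v) + r) (hA ▸ Set.add_mem_add (Set.add_mem_add hv₁ hv₂) hr)
  have hext : intVec (b + v + c + r) ∈
      (convexHull ℝ (intVec '' columnSums N α)).extremePoints ℝ := by
    rw [← hfree]
    exact ⟨m2, intVec_mem_integerLattice _⟩
  -- The vector with `v` applied once is the midpoint of those with `v` applied in neither and in
  -- both columns.
  have heq := hext.2 m1 m3 ⟨1 / 2, 1 / 2, by norm_num, by norm_num, by norm_num, by
    ext i; simp; ring⟩
  have := intVec_injective heq
  apply hv
  have e : b + v + c + r = b + c + r + v := by abel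
  rw [e] at this
  simpa using this.symm

theorem ehrhart_one {n : ℕ} {B : Set (Fin n → ℤ)} (hB : ExchangeClosed B) :
    ehrhart (convexHull ℝ (intVec '' B)) 1 = B.ncard := by
  rw [ehrhart, Nat.cast_one, one_smul, hB.convexHull_inter_integerLattice,
    Set.ncard_image_of_injective _ intVec_injective]

theorem corollary1p4 (n : ℕ) (α : Fin n → ℕ)
    (κ : MvPolynomial (Fin n) ℤ) (hκ : IsKeyPolynomial α κ)
    (N : ℕ) (hN : ∀ i, α i ≤ N) :
    List.TFAE [
      IsLatticeFree (newtonPolytope κ),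
      AvoidsZeroTwo α,
      ∀ t : ℕ, ehrhart (newtonPolytope κ) t =
        ∏ j ∈ Finset.Icc 1 N, ehrhart (matroidBasePolytope (schubertMatroid (skylineColumn α j))) t] := by
  have hext := extremePoints_newtonPolytope_subset (κ := κ)
  simp only [matroidBasePolytope_schubertMatroid, hκ.newtonPolytope_eq hN] at hext ⊢
  tfae_have 1 → 2 := by
    intro h
    by_contra hno
    exact not_isLatticeFree hN hno h
  tfae_have 2 → 1 := by
    intro h
    refine Set.Subset.antisymm ?_ hext
    rintro x ⟨hx, hxZ⟩
    refine mem_extremePoints_of_unitAt (fun i => ?_) hx hxZ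
    rw [convexHull_columnSums]
    exact (h.varyDisjointly _).unitAt_sum fun k _ => unitAt_galeVectors _ i
  tfae_have 2 → 3 := by
    intro h t
    simp only [ehrhart]
    rw [convexHull_columnSums, Finset.smul_sum]
    refine VaryDisjointly.ncard_sum_inter_integerLattice fun i j hj k hk hjk => ?_
    exact (h.varyDisjointly _ i j hj k hk hjk).imp (·.natCast_smul t) (·.natCast_smul t)
  tfae_have 3 → 2 := by
    intro h
    by_contra hno
    -- At `t = 1` both sides count integer vectors exactly, since exchange-closed sets have no
    -- holes; the collision of sums makes the left side strictly smaller.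
    have h1 := h 1
    simp only [ehrhart_one (exchangeClosed_galeVectors _),
      ehrhart_one (exchangeClosed_columnSums N α)] at h1
    exact (ncard_columnSums_lt hN hno).ne h1
  tfae_finish
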